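/- Let $\mathbb T=\mathbb R/\mathbb Z$ be the circle with Haar (Lebesgue) probability measure $\lambda$, let $\alpha\in\mathbb R$ be irrational, let $R_\alpha(x)=x+\alpha$ be the corresponding irrational rotation, let $h:\mathbb T\to\mathbb T$ be a homeomorphism, and let $\phi=h\circ R_\alpha\circ h^{-1}$. Let $C(\mathbb T)\rtimes_\phi\mathbb Z$ be the crossed product $C^*$-algebra, i.e. the universal $C^*$-algebra generated by a copy of $C(\mathbb T)$ and a unitary $U$ such that $UfU^*=f\circ\phi^{-1}$ for all $f\in C(\mathbb T)$. Let $F:\mathbb T\to\mathbb R$ be continuous, and let $\alpha^F=(\alpha^F_t)_{t\in\mathbb R}$ be the flow on $C(\mathbb T)\rtimes_\phi\mathbb Z$ determined by $\alpha^F_t(fU)=fUe^{-itF}$ for $f\in C(\mathbb T)$. For $\beta\in\mathbb R$, a state $\omega$ on $C(\mathbb T)\rtimes_\phi\mathbb Z$ is a $\beta$-KMS state for $\alpha^F$ when there is a dense $\alpha^F$-invariant $*$-algebra of entire $\alpha^F$-analytic elements such that $\omega(ab)=\omega(b\,\alpha^F_{i\beta}(a))$ for all $a,b$ in it. Then: 1.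 There is a $\beta$-KMS state for $\alpha^F$ for some $\beta\neq 0$ if and only if $\int_{\mathbb T}F\circ h\,d\lambda=0$. 2. If $\int_{\mathbb T}F\circ h\,d\lambda=0$, then there is a $\beta$-KMS state for $\alpha^F$ for every $\beta\in\mathbb R$. 3. If $F$ has bounded variation on $\mathbb T$, then for each $\beta\in\mathbb R$ there is at most one $\beta$-KMS state for $\alpha^F$. In particular, if moreover $\int_{\mathbb T}F\circ h\,d\lambda=0$, there is exactly one $\beta$-KMS state for each $\beta\in\mathbb R$. -/

import Mathlib

open scoped ENNReal ComplexOrder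

universe u

noncomputable section

section CrossedProduct

variable {X : Type u} [TopologicalSpace X]

/-- A covariant representation of `(X, φ)` in a unital C*-algebra `B`: a unital `*`-homomorphism
`π : C(X) → B` and a unitary `u ∈ B` with `u π(f) u* = π(f ∘ φ⁻¹)`. -/
structure CovariantRep (φ : X ≃ₜ X) where
  B : Type u
  [cstar : CStarAlgebra B]
  [nontriv : Nontrivial B]
  π : C(X, ℂ) →⋆ₐ[ℂ] B
  u : B
  mem_unitary : u ∈ unitary B
  covariant : ∀ f : C(X, ℂ), u * π f * star u = π (f.comp (φ.symm : C(X, X)))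

attribute [instance] CovariantRep.cstar CovariantRep.nontriv

/-- The function `x ↦ exp (-i t F x)`. -/
def phase (F : C(X, ℝ)) (t : ℝ) : C(X, ℂ) where
  toFun x := Complex.exp (-(Complex.I * t * F x))
  continuous_toFun := by fun_prop

theorem phase_mul_phase (F : C(X, ℝ)) (s t : ℝ) : phase F s * phase F t = phase F (s + t) := by
  ext x
  simp only [phase, ContinuousMap.mul_apply, ContinuousMap.coe_mk, ← Complex.exp_add]
  congr 1
  push_cast
  ring

theorem phase_zero (F : C(X, ℝ)) : phase F 0 = 1 := by
  ext x
  simp [phase]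

theorem star_phase (F : C(X, ℝ)) (t : ℝ) : star (phase F t) = phase F (-t) := by
  ext x
  simp only [phase, ContinuousMap.star_apply, ContinuousMap.coe_mk]
  rw [Complex.star_def, ← Complex.exp_conj]
  simp

theorem phase_mem_unitary (F : C(X, ℝ)) (t : ℝ) : phase F t ∈ unitary C(X, ℂ) := by
  rw [Unitary.mem_iff, star_phase, phase_mul_phase, phase_mul_phase]
  simp [phase_zero]

/-- The covariant representation `(π, u π(e^{-itF}))`. -/
def CovariantRep.twist {φ : X ≃ₜ X} (ρ : CovariantRep φ) (F : C(X, ℝ)) (t : ℝ) :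
    CovariantRep φ where
  B := ρ.B
  π := ρ.π
  u := ρ.u * ρ.π (phase F t)
  mem_unitary := mul_mem ρ.mem_unitary (Unitary.map_mem ρ.π (phase_mem_unitary F t))
  covariant f := by
    have h : phase F t * f * star (phase F t) = f := by
      rw [mul_right_comm, (Unitary.mem_iff.1 (phase_mem_unitary F t)).2, one_mul]
    calc ρ.u * ρ.π (phase F t) * ρ.π f * star (ρ.u * ρ.π (phase F t))
        = ρ.u * ρ.π (phase F t * f * star (phase F t)) * star ρ.u := by
          simp only [map_mul, map_star, star_mul, mul_assoc]
      _ = _ := by rw [h, ρ.covariant]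

theorem CovariantRep.twist_twist {φ : X ≃ₜ X} (ρ : CovariantRep φ) (F : C(X, ℝ)) (s t : ℝ) :
    (ρ.twist F s).twist F t = ρ.twist F (s + t) := by
  have h : ρ.u * ρ.π (phase F s) * ρ.π (phase F t) = ρ.u * ρ.π (phase F (s + t)) := by
    rw [mul_assoc, ← map_mul, phase_mul_phase]
  have key : ∀ (v w : ρ.B) (hv : v ∈ unitary ρ.B) (hw : w ∈ unitary ρ.B)
      (cv : ∀ f : C(X, ℂ), v * ρ.π f * star v = ρ.π (f.comp (φ.symm : C(X, X))))
      (cw : ∀ f : C(X, ℂ), w * ρ.π f * star w = ρ.π (f.comp (φ.symm : C(X, X)))), v = w →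
      (⟨ρ.B, ρ.π, v, hv, cv⟩ : CovariantRep φ) = ⟨ρ.B, ρ.π, w, hw, cw⟩ := by
    rintro v _ hv _ cv _ rfl
    rfl
  exact key _ _ _ _ _ _ h

theorem CovariantRep.twist_zero {φ : X ≃ₜ X} (ρ : CovariantRep φ) (F : C(X, ℝ)) :
    ρ.twist F 0 = ρ := by
  cases ρ
  simp [twist, phase_zero]

/-- The `ℓ^∞`-product of the target algebras of all covariant representations of `(X, φ)`. -/
abbrev CovariantProduct (φ : X ≃ₜ X) : Type (u + 1) :=
  lp (fun ρ : CovariantRep φ => ρ.B) ∞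

instance (φ : X ≃ₜ X) : CStarAlgebra (CovariantProduct φ) where

variable [CompactSpace X]

/-- The product of all the `*`-homomorphisms `π`. -/
def productFunction (φ : X ≃ₜ X) : C(X, ℂ) →⋆ₐ[ℂ] CovariantProduct φ where
  toFun f := ⟨fun ρ => ρ.π f, memℓp_infty ⟨‖f‖, by
    rintro _ ⟨ρ, rfl⟩
    exact NonUnitalStarAlgHom.norm_apply_le ρ.π f⟩⟩
  map_one' := by ext ρ; exact map_one ρ.π
  map_mul' f g := by ext ρ; exact map_mul ρ.π f g
  map_zero' := by ext ρ; exact map_zero ρ.π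
  map_add' f g := by ext ρ; exact map_add ρ.π f g
  commutes' c := by ext ρ; exact AlgHomClass.commutes ρ.π c
  map_star' f := by ext ρ; exact map_star ρ.π f

/-- The product of all the unitaries `u`. -/
def productUnitary (φ : X ≃ₜ X) : CovariantProduct φ :=
  ⟨fun ρ => ρ.u, memℓp_infty ⟨1, by
    rintro _ ⟨ρ, rfl⟩
    exact (CStarRing.norm_of_mem_unitary ρ.mem_unitary).le⟩⟩

/-- The `*`-algebra generated by `C(X)` and `U`. -/
def productAdjoin (φ : X ≃ₜ X) : StarSubalgebra ℂ (CovariantProduct φ) :=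
  StarAlgebra.adjoin ℂ (insert (productUnitary φ) (Set.range (productFunction φ)))

/-- The crossed product `C(X) ⋊_φ ℤ`: the universal C*-algebra generated by a copy of `C(X)` and a
unitary `U` with `U f U* = f ∘ φ⁻¹`. It is built as the C*-algebra generated by `C(X)` and `U` in
the product of all covariant representations, that is, as the completion in the largest C*-norm;
its universal property is `CrossedProduct.existsUnique_lift`. -/
abbrev CrossedProduct (φ : X ≃ₜ X) : Type (u + 1) :=
  (productAdjoin φ).topologicalClosure

instance (φ : X ≃ₜ X) : CStarAlgebra (CrossedProduct φ) :=
  StarSubalgebra.cstarAlgebra _ (h_closed := (productAdjoin φ).isClosed_topologicalClosure)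

namespace CrossedProduct

theorem function_mem (φ : X ≃ₜ X) (f : C(X, ℂ)) :
    productFunction φ f ∈ (productAdjoin φ).topologicalClosure :=
  (productAdjoin φ).le_topologicalClosure
    (StarAlgebra.subset_adjoin ℂ _ (Set.mem_insert_of_mem _ ⟨f, rfl⟩))

theorem unitary_mem (φ : X ≃ₜ X) : productUnitary φ ∈ (productAdjoin φ).topologicalClosure :=
  (productAdjoin φ).le_topologicalClosure
    (StarAlgebra.subset_adjoin ℂ _ (Set.mem_insert _ _))

/-- The canonical copy of `C(X)` in the crossed product. -/
def ofFunction (φ : X ≃ₜ X) : C(X, ℂ) →⋆ₐ[ℂ] CrossedProduct φ :=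
  (productFunction φ).codRestrict _ (function_mem φ)

/-- The canonical unitary `U`. -/
def U (φ : X ≃ₜ X) : CrossedProduct φ := ⟨productUnitary φ, unitary_mem φ⟩

theorem U_mem_unitary (φ : X ≃ₜ X) : U φ ∈ unitary (CrossedProduct φ) := by
  constructor
  · ext ρ; exact (Unitary.mem_iff.1 ρ.mem_unitary).1
  · ext ρ; exact (Unitary.mem_iff.1 ρ.mem_unitary).2

theorem U_covariant (φ : X ≃ₜ X) (f : C(X, ℂ)) :
    U φ * ofFunction φ f * star (U φ) = ofFunction φ (f.comp (φ.symm : C(X, X))) := by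
  ext ρ; exact ρ.covariant f

/-- Two continuous `*`-homomorphisms that agree on `C(X)` and on `U` are equal. -/
theorem hom_ext {φ : X ≃ₜ X} {C : Type*} [TopologicalSpace C] [T2Space C] [Ring C] [StarRing C]
    [Algebra ℂ C] {ψ₁ ψ₂ : CrossedProduct φ →⋆ₐ[ℂ] C} (h₁ : Continuous ψ₁) (h₂ : Continuous ψ₂)
    (hf : ∀ f, ψ₁ (ofFunction φ f) = ψ₂ (ofFunction φ f)) (hU : ψ₁ (U φ) = ψ₂ (U φ)) :
    ψ₁ = ψ₂ := by
  refine StarAlgHom.ext_topologicalClosure h₁ h₂ ?_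
  refine StarAlgHom.ext_adjoin ?_
  rintro ⟨x, hx⟩ hx'
  rcases hx' with rfl | ⟨f, rfl⟩
  · exact hU
  · exact hf f

/-- The universal property. -/
theorem existsUnique_lift {φ : X ≃ₜ X} (ρ : CovariantRep φ) :
    ∃! ψ : CrossedProduct φ →⋆ₐ[ℂ] ρ.B, (∀ f, ψ (ofFunction φ f) = ρ.π f) ∧ ψ (U φ) = ρ.u := by
  let ev : CovariantProduct φ →⋆ₐ[ℂ] ρ.B :=
    { toFun := fun x => x ρ
      map_one' := rfl
      map_mul' := fun _ _ => rfl
      map_zero' := rfl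
      map_add' := fun _ _ => rfl
      commutes' := fun _ => rfl
      map_star' := fun _ => rfl }
  refine ⟨ev.comp (StarSubalgebra.subtype _), ⟨fun f => rfl, rfl⟩, ?_⟩
  rintro ψ ⟨h₁, h₂⟩
  exact hom_ext
    (NonUnitalStarAlgHom.instContinuousLinearMapClassComplex.toContinuousMapClass.map_continuous ψ)
    (NonUnitalStarAlgHom.instContinuousLinearMapClassComplex.toContinuousMapClass.map_continuous _) h₁ h₂

end CrossedProduct

/-- Reindexing along `ρ ↦ ρ.twist F t`. -/
def productTwist (φ : X ≃ₜ X) (F : C(X, ℝ)) (t : ℝ) :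
    CovariantProduct φ →⋆ₐ[ℂ] CovariantProduct φ where
  toFun x := ⟨fun ρ => x (ρ.twist F t), memℓp_infty ⟨‖x‖, by
    rintro _ ⟨ρ, rfl⟩
    exact lp.norm_apply_le_norm ENNReal.top_ne_zero x (ρ.twist F t)⟩⟩
  map_one' := rfl
  map_mul' _ _ := rfl
  map_zero' := rfl
  map_add' _ _ := rfl
  commutes' _ := rfl
  map_star' _ := rfl

theorem productTwist_function (φ : X ≃ₜ X) (F : C(X, ℝ)) (t : ℝ) (f : C(X, ℂ)) :
    productTwist φ F t (productFunction φ f) = productFunction φ f := rfl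

theorem productTwist_unitary (φ : X ≃ₜ X) (F : C(X, ℝ)) (t : ℝ) :
    productTwist φ F t (productUnitary φ) = productUnitary φ * productFunction φ (phase F t) := rfl

theorem productTwist_mem (φ : X ≃ₜ X) (F : C(X, ℝ)) (t : ℝ) {x : CovariantProduct φ}
    (hx : x ∈ (productAdjoin φ).topologicalClosure) :
    productTwist φ F t x ∈ (productAdjoin φ).topologicalClosure := by
  have hc : Continuous (productTwist φ F t) :=
    NonUnitalStarAlgHom.instContinuousLinearMapClassComplex.toContinuousMapClass.map_continuous _
  have h : productAdjoin φ ≤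
      StarSubalgebra.comap (productTwist φ F t) (productAdjoin φ).topologicalClosure := by
    refine StarAlgebra.adjoin_le ?_
    rintro _ (rfl | ⟨f, rfl⟩)
    · exact mul_mem (CrossedProduct.unitary_mem φ) (CrossedProduct.function_mem φ _)
    · exact CrossedProduct.function_mem φ f
  exact StarSubalgebra.topologicalClosure_minimal h
    ((productAdjoin φ).isClosed_topologicalClosure.preimage hc) hx

theorem productTwist_productTwist (φ : X ≃ₜ X) (F : C(X, ℝ)) (s t : ℝ) (x : CovariantProduct φ) :
    productTwist φ F s (productTwist φ F t x) = productTwist φ F (s + t) x := by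
  ext ρ
  have key : ∀ σ : CovariantRep φ, σ = ρ.twist F (s + t) → HEq (x σ) (x (ρ.twist F (s + t))) := by
    rintro _ rfl
    rfl
  exact eq_of_heq (key _ (ρ.twist_twist F s t))

theorem productTwist_zero (φ : X ≃ₜ X) (F : C(X, ℝ)) (x : CovariantProduct φ) :
    productTwist φ F 0 x = x := by
  ext ρ
  have key : ∀ σ : CovariantRep φ, σ = ρ → HEq (x σ) (x ρ) := by
    rintro _ rfl
    rfl
  exact eq_of_heq (key _ (ρ.twist_zero F))

/-- The automorphism `α^F_t` of `C(X) ⋊_φ ℤ` with `α^F_t (f U) = f U e^{-itF}`. -/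
def crossedFlow (φ : X ≃ₜ X) (F : C(X, ℝ)) (t : ℝ) : CrossedProduct φ ≃⋆ₐ[ℂ] CrossedProduct φ where
  toFun x := ⟨productTwist φ F t x, productTwist_mem φ F t x.2⟩
  invFun x := ⟨productTwist φ F (-t) x, productTwist_mem φ F (-t) x.2⟩
  left_inv x := by
    ext1
    simp [productTwist_productTwist, productTwist_zero]
  right_inv x := by
    ext1
    simp [productTwist_productTwist, productTwist_zero]
  map_mul' _ _ := rfl
  map_add' _ _ := rfl
  map_star' _ := rfl
  map_smul' c x := by
    ext1
    exact map_smul (productTwist φ F t) c (x : CovariantProduct φ)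

theorem crossedFlow_ofFunction_mul_U (φ : X ≃ₜ X) (F : C(X, ℝ)) (t : ℝ) (f : C(X, ℂ)) :
    crossedFlow φ F t (CrossedProduct.ofFunction φ f * CrossedProduct.U φ) =
      CrossedProduct.ofFunction φ f * CrossedProduct.U φ *
        CrossedProduct.ofFunction φ (phase F t) := by
  rw [mul_assoc]
  rfl

theorem crossedFlow_add (φ : X ≃ₜ X) (F : C(X, ℝ)) (s t : ℝ) (x : CrossedProduct φ) :
    crossedFlow φ F (s + t) x = crossedFlow φ F s (crossedFlow φ F t x) :=
  Subtype.ext (productTwist_productTwist φ F s t x).symm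

end CrossedProduct

section KMS

variable {A : Type*} [CStarAlgebra A]

/-- `f` is the entire extension `z ↦ α_z(a)` of the orbit map `t ↦ α_t(a)`; `a` is an (entire)
analytic element for `α` when such an `f` exists, and then `f` is unique. -/
def IsEntireExtension (α : ℝ → A ≃⋆ₐ[ℂ] A) (a : A) (f : ℂ → A) : Prop :=
  Differentiable ℂ f ∧ ∀ t : ℝ, f t = α t a

/-- `ω` is a `β`-KMS state for the flow `α`: it is a state, and `ω(ab) = ω(b α_{iβ}(a))` for all
`a`, `b` in some dense `α`-invariant `*`-algebra of `α`-analytic elements. -/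
structure IsKMSState (α : ℝ → A ≃⋆ₐ[ℂ] A) (β : ℝ) (ω : A →L[ℂ] ℂ) : Prop where
  nonneg : ∀ a : A, 0 ≤ ω (star a * a)
  map_one : ω 1 = 1
  kms : ∃ D : NonUnitalStarSubalgebra ℂ A, Dense (D : Set A) ∧
    (∀ t : ℝ, ∀ a ∈ D, α t a ∈ D) ∧
    ∀ a ∈ D, ∃ f : ℂ → A, IsEntireExtension α a f ∧
      ∀ b ∈ D, ω (a * b) = ω (b * f (Complex.I * β))

end KMS

end

/-! In the coordinate x = h(y) the map `φ` is the rotation by `α`. Restricted to functions, a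
`β`-KMS state is a probability measure m which in this coordinate satisfies ∫ g(y - α) dm = ∫ exp(W)
g dm with W = β F∘h. The theorem is about such conformal measures, kept here as positive functionals
(`IsConformal`).

Necessity: n iterations tested on g = 1 give ∫ exp(S_n) dm = 1 for the Birkhoff sums S_n of W. By
equidistribution S_n = n ∫ W + o(n) uniformly, so ∫ W = 0 (`IsConformal.integral_eq_zero`).

Existence: if ∫ W = 0, then S_n grows sublinearly along an orbit in both directions, so the weights
exp(S_n - s|n|) are summable, and they are conformal up to a factor between exp(-s) and exp(s).
Mixing the vector states of the orbit representation on ℓ²(ℤ) with these weights gives approximate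
KMS states (`exists_approx_KMS`), and a weak-* limit as s tends to 0 is a KMS state.

Uniqueness: for any F, a KMS state vanishes on f U^k with k ≠ 0 (`IsKMSState.monomial_eq_zero`), so
the measure determines it. If F has bounded variation, a Denjoy–Koksma estimate bounds the
oscillation of S_j, j < q, at scale 1/q, where q is the denominator of a Dirichlet approximation of
`α`. The mass near x at that scale is then, up to a constant factor, the reciprocal of the sum of
exp(S_j(x)) over j < q, which does not involve m. So any two conformal measures are comparable, and
subtracting the largest possible multiple of one from the other shows that they agree
(`IsConformal.unique`).

The definition asks for the KMS identity only on some dense algebra, which may depend on the state.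
`IsKMSState.apply_mul_eq` removes this dependence, and `isKMSState_iff` reduces the condition to
identities for the generators. -/

open Filter Topology MeasureTheory
open scoped InnerProductSpace

/-! ### Gaussian smoothing on the line -/

/-- Shift of the line of integration for an entire function with Gaussian decay on a strip. -/
theorem integral_eq_integral_add_mul_I {H : ℂ → ℂ} (hH : Differentiable ℂ H) {β k B : ℝ}
    (hk : 0 < k)
    (hB : ∀ t : ℝ, ∀ s ∈ Set.uIcc 0 β, ‖H (t + s * Complex.I)‖ ≤ B * Real.exp (-k * t ^ 2)) :
    ∫ t : ℝ, H t = ∫ t : ℝ, H (t + β * Complex.I) := by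
  have hc : Continuous H := hH.continuous
  have hint : ∀ s ∈ Set.uIcc 0 β, Integrable fun t : ℝ => H (t + s * Complex.I) := fun s hs =>
    ((integrable_exp_neg_mul_sq hk).const_mul B).mono' (by fun_prop)
      (Eventually.of_forall fun t => hB t s hs)
  have h₀ : Integrable fun t : ℝ => H t := by simpa using hint 0 Set.left_mem_uIcc
  have t₁ := intervalIntegral_tendsto_integral h₀ tendsto_neg_atTop_atBot tendsto_id
  have t₂ := intervalIntegral_tendsto_integral (hint β Set.right_mem_uIcc)
    tendsto_neg_atTop_atBot tendsto_id
  have hlim : Tendsto (fun T : ℝ => B * Real.exp (-k * T ^ 2) * |β - 0|) atTop (𝓝 0) := by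
    have h : Tendsto (fun T : ℝ => Real.exp (-k * T ^ 2)) atTop (𝓝 0) := by
      refine Real.tendsto_exp_atBot.comp ?_
      simp_rw [neg_mul]
      exact tendsto_neg_atTop_atBot.comp
        ((tendsto_const_mul_atTop_of_pos hk).2 (tendsto_pow_atTop two_ne_zero))
    simpa using (h.const_mul B).mul_const |β - 0|
  -- The two signs of σ cover the two vertical sides of the rectangle.
  have hside : ∀ σ : ℝ, σ ^ 2 = 1 →
      Tendsto (fun T : ℝ => ∫ s in (0 : ℝ)..β, H ((σ * T : ℝ) + s * Complex.I)) atTop (𝓝 0) := by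
    intro σ hσ
    refine squeeze_zero_norm (fun T => ?_) hlim
    refine intervalIntegral.norm_integral_le_of_norm_le_const fun s hs => ?_
    have := hB (σ * T) s (Set.uIoc_subset_uIcc hs)
    rwa [mul_pow, hσ, one_mul] at this
  have key : ∀ T : ℝ, (∫ t : ℝ in -T..T, H t) - (∫ t : ℝ in -T..T, H (t + β * Complex.I)) +
      Complex.I * (∫ s in (0 : ℝ)..β, H ((1 * T : ℝ) + s * Complex.I)) -
      Complex.I * (∫ s in (0 : ℝ)..β, H (((-1) * T : ℝ) + s * Complex.I)) = 0 := by
    intro T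
    have := Complex.integral_boundary_rect_eq_zero_of_differentiableOn H (-T) (T + β * Complex.I)
      hH.differentiableOn
    simpa only [Complex.neg_im, Complex.ofReal_im, neg_zero, Complex.ofReal_zero, zero_mul,
      add_zero, Complex.neg_re, Complex.ofReal_re, Complex.add_re, Complex.mul_re, Complex.I_re,
      mul_zero, Complex.I_im, tsub_zero, Complex.add_im, Complex.mul_im, mul_one, zero_add,
      smul_eq_mul, Complex.ofReal_neg, one_mul, neg_one_mul] using this
  have hz := (((t₁.sub t₂).add ((hside 1 (by norm_num)).const_mul Complex.I)).sub
    ((hside (-1) (by norm_num)).const_mul Complex.I))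
  simp only [id, key, mul_zero, add_zero, sub_zero] at hz
  exact sub_eq_zero.1 (tendsto_nhds_unique hz tendsto_const_nhds)

/-- The Gaussian centred at βi becomes the real Gaussian on the line of height β. Off that line its
modulus grows by at most exp(kβ²), because |s - β| ≤ |β| on the strip. -/
theorem integral_gaussian_mul_shift {g : ℂ → ℂ} (hg : Differentiable ℂ g) {β k B : ℝ} (hk : 0 < k)
    (hB : ∀ t : ℝ, ∀ s ∈ Set.uIcc 0 β, ‖g (t + s * Complex.I)‖ ≤ B) :
    ∫ t : ℝ, Complex.exp (-k * (t - β * Complex.I) ^ 2) * g t =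
      ∫ t : ℝ, Complex.exp (-k * t ^ 2) * g (t + β * Complex.I) := by
  have h := integral_eq_integral_add_mul_I
    (H := fun z => Complex.exp (-k * (z - β * Complex.I) ^ 2) * g z) (β := β)
    (B := Real.exp (k * β ^ 2) * B) (by fun_prop) hk fun t s hs => by
      have h₁ : ((-k : ℂ) * (t + s * Complex.I - β * Complex.I) ^ 2).re ≤
          k * β ^ 2 + -k * t ^ 2 := by
        have : ((-k : ℂ) * (t + s * Complex.I - β * Complex.I) ^ 2).re =
            k * (s - β) ^ 2 + -k * t ^ 2 := by
          simp [pow_two]; ring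
        rw [this]
        have : (s - β) ^ 2 ≤ β ^ 2 := by
          rw [sq_le_sq]
          have := Set.abs_sub_right_of_mem_uIcc hs
          rwa [sub_zero, abs_sub_comm] at this
        gcongr
      calc ‖Complex.exp (-k * (t + s * Complex.I - β * Complex.I) ^ 2) * g (t + s * Complex.I)‖
          ≤ Real.exp (k * β ^ 2 + -k * t ^ 2) * B := by
            rw [norm_mul, Complex.norm_exp]
            gcongr
            exact hB t s hs
        _ = _ := by rw [Real.exp_add]; ring
  simpa using h

/-- With k = (n + 1)² and t rescaled by n + 1, the Gaussians concentrate at 0; dominated convergence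
leaves u(0) times a nonzero integral. -/
theorem eq_zero_of_integral_gaussian_mul_eq_zero {u : ℝ → ℂ} (hu : Continuous u) {B : ℝ}
    (hB : ∀ t, ‖u t‖ ≤ B)
    (h : ∀ k : ℝ, 0 < k → ∫ t : ℝ, Complex.exp (-k * t ^ 2) * u t = 0) : u 0 = 0 := by
  have hs : ∀ n : ℕ, ∫ t : ℝ, Complex.exp (-(1 : ℝ) * t ^ 2) * u (((n : ℝ) + 1)⁻¹ * t) = 0 := by
    intro n
    have hn : (0 : ℝ) < (n : ℝ) + 1 := by positivity
    have h₁ := Measure.integral_comp_mul_left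
      (fun t : ℝ => Complex.exp (-((((n : ℝ) + 1) ^ 2 : ℝ) : ℂ) * t ^ 2) * u t) ((n : ℝ) + 1)⁻¹
    rw [h _ (by positivity), smul_zero] at h₁
    rw [← h₁]
    congr 1
    ext t
    congr 2
    have : (n : ℂ) + 1 ≠ 0 := by exact_mod_cast hn.ne'
    push_cast
    field_simp
  have hint : Integrable fun t : ℝ => Real.exp (-1 * t ^ 2) * B :=
    (integrable_exp_neg_mul_sq one_pos).mul_const B
  have hlim : Tendsto (fun n : ℕ => ∫ t : ℝ, Complex.exp (-(1 : ℝ) * t ^ 2) *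
      u (((n : ℝ) + 1)⁻¹ * t)) atTop (𝓝 (∫ t : ℝ, Complex.exp (-(1 : ℝ) * t ^ 2) * u 0)) := by
    refine tendsto_integral_of_dominated_convergence _ (fun n => by fun_prop) hint
      (fun n => Eventually.of_forall fun t => ?_) (Eventually.of_forall fun t => ?_)
    · rw [norm_mul, Complex.norm_exp]
      have : ((-(1 : ℝ) : ℂ) * (t : ℂ) ^ 2).re = -1 * t ^ 2 := by simp [pow_two]
      rw [this]
      gcongr
      exact hB _
    · refine Tendsto.const_mul _ ?_
      have h₁ : Tendsto (fun n : ℕ => ((n : ℝ) + 1)⁻¹ * t) atTop (𝓝 (0 * t)) := by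
        have := tendsto_one_div_add_atTop_nhds_zero_nat (𝕜 := ℝ)
        simp only [one_div] at this
        exact this.mul_const t
      rw [zero_mul] at h₁
      exact (hu.tendsto 0).comp h₁
  simp only [hs] at hlim
  have h₀ := tendsto_nhds_unique hlim tendsto_const_nhds
  rw [integral_mul_const] at h₀
  refine (mul_eq_zero.1 h₀).resolve_left ?_
  have := integral_gaussian_complex (b := ((1 : ℝ) : ℂ)) (by simp)
  rw [this]
  simp [Real.pi_ne_zero]

/-! ### The KMS condition for all analytic elements -/

section KMS

variable {A : Type*} [CStarAlgebra A] {α : ℝ → A ≃⋆ₐ[ℂ] A}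

theorem starAlgEquiv_continuous (σ : A ≃⋆ₐ[ℂ] A) : Continuous σ :=
  NonUnitalStarAlgHom.instContinuousLinearMapClassComplex.toContinuousMapClass.map_continuous
    (σ : A →⋆ₐ[ℂ] A)

theorem starAlgEquiv_norm (σ : A ≃⋆ₐ[ℂ] A) (a : A) : ‖σ a‖ = ‖a‖ :=
  NonUnitalStarAlgHom.norm_map (σ : A →⋆ₐ[ℂ] A) σ.injective a

theorem eq_of_eqOn_real {E : Type*} [NormedAddCommGroup E] [NormedSpace ℂ E] [CompleteSpace E]
    {f g : ℂ → E} (hf : Differentiable ℂ f)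
    (hg : Differentiable ℂ g) (h : ∀ t : ℝ, f t = g t) : f = g := by
  refine AnalyticOnNhd.eq_of_frequently_eq (z₀ := 0)
    (fun z _ => hf.analyticAt z) (fun z _ => hg.analyticAt z) ?_
  have ht : Tendsto (fun t : ℝ => (t : ℂ)) (𝓝[≠] 0) (𝓝[≠] 0) := by
    refine tendsto_nhdsWithin_of_tendsto_nhds_of_eventually_within _ ?_ ?_
    · exact (Complex.continuous_ofReal.tendsto' 0 0 (by simp)).mono_left nhdsWithin_le_nhds
    · filter_upwards [self_mem_nhdsWithin] with t ht
      simpa using ht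
  exact ht.frequently (Frequently.of_forall h)

/-- Both sides are entire in z and agree for real z by the group law. -/
theorem IsEntireExtension.apply_add (hα : ∀ s t a, α (s + t) a = α s (α t a)) {a : A} {f : ℂ → A}
    (hf : IsEntireExtension α a f) (t : ℝ) (z : ℂ) : f (t + z) = α t (f z) := by
  have h₂ : Differentiable ℂ fun z => α t (f z) := by
    let L : A →L[ℂ] A := ⟨(α t : A →⋆ₐ[ℂ] A).toAlgHom.toLinearMap, starAlgEquiv_continuous (α t)⟩
    exact L.differentiable.comp hf.1
  refine congrFun (eq_of_eqOn_real (f := fun z => f (t + z)) (g := fun z => α t (f z))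
    (hf.1.comp (differentiable_id.const_add _)) h₂ fun s => ?_) z
  have := hf.2 (t + s)
  push_cast at this
  rw [this, hf.2, hα]

/-- Real translations act isometrically, so a bound on one compact vertical segment holds on the
whole strip. -/
theorem IsEntireExtension.exists_bound (hα : ∀ s t a, α (s + t) a = α s (α t a)) {a : A}
    {f : ℂ → A} (hf : IsEntireExtension α a f) (β : ℝ) :
    ∃ B, ∀ t : ℝ, ∀ s ∈ Set.uIcc 0 β, ‖f (t + s * Complex.I)‖ ≤ B := by
  have hc := hf.1.continuous
  obtain ⟨B, hB⟩ := (isCompact_uIcc (a := (0 : ℝ)) (b := β)).exists_bound_of_continuousOn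
    (f := fun s : ℝ => f (s * Complex.I)) (by fun_prop)
  exact ⟨B, fun t s hs => by rw [hf.apply_add hα, starAlgEquiv_norm]; exact hB s hs⟩

/-- The KMS condition, required on some dense `*`-algebra of analytic elements, holds for all
analytic elements. -/
theorem IsKMSState.apply_mul_eq (hα : ∀ s t a, α (s + t) a = α s (α t a)) {β : ℝ}
    {ω : A →L[ℂ] ℂ} (hω : IsKMSState α β ω) {a : A} {f : ℂ → A} (hf : IsEntireExtension α a f)
    (b : A) : ω (a * b) = ω (b * f (Complex.I * β)) := by
  obtain ⟨D, hD, hinv, hkms⟩ := hω.kms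
  -- reduce to `b ∈ D`
  suffices H : ∀ b ∈ D, ω (a * b) = ω (b * f (Complex.I * β)) by
    have h₁ : Continuous fun b => ω (a * b) := by fun_prop
    have h₂ : Continuous fun b => ω (b * f (Complex.I * β)) := by fun_prop
    exact congrFun (h₁.ext_on hD h₂ H) b
  clear b
  intro b hb
  have hgd : ∀ {c : A} {g : ℂ → A}, IsEntireExtension α c g →
      Differentiable ℂ fun z => ω (b * g z) := fun hg =>
    ω.differentiable.comp (hg.1.const_mul b)
  have hshift : ∀ {c : A} {g : ℂ → A}, IsEntireExtension α c g → ∀ k : ℝ, 0 < k →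
      ∫ t : ℝ, Complex.exp (-k * (t - β * Complex.I) ^ 2) * ω (b * α t c) =
        ∫ t : ℝ, Complex.exp (-k * t ^ 2) * ω (b * g (t + β * Complex.I)) := by
    intro c g hg k hk
    obtain ⟨B, hB⟩ := hg.exists_bound hα β
    rw [← integral_gaussian_mul_shift (g := fun z => ω (b * g z)) (hgd hg) hk
      (B := ‖ω‖ * (‖b‖ * B))]
    · simp_rw [hg.2]
    · intro t s hs
      refine (ω.le_opNorm _).trans ?_
      gcongr
      refine (norm_mul_le _ _).trans ?_
      gcongr
      exact hB t s hs
  -- the smoothed identity for elements of `D`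
  have hsm : ∀ c ∈ D, ∀ k : ℝ, 0 < k →
      ∫ t : ℝ, Complex.exp (-k * (t - β * Complex.I) ^ 2) * ω (b * α t c) =
        ∫ t : ℝ, Complex.exp (-k * t ^ 2) * ω (α t c * b) := by
    intro c hc k hk
    obtain ⟨g, hg, -⟩ := hkms c hc
    rw [hshift hg k hk]
    congr 1
    ext t
    congr 1
    -- The KMS identity is used for α_t(c), which lies in D by invariance; its extension is a
    -- translate of that of c.
    obtain ⟨g', hg', h'⟩ := hkms _ (hinv t c hc)
    rw [h' b hb]
    have : g' = fun z => g (t + z) := by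
      refine eq_of_eqOn_real hg'.1 (hg.1.comp (differentiable_id.const_add _)) fun s => ?_
      rw [hg'.2, ← hα, add_comm, ← hg.2]
      push_cast
      rfl
    rw [this, mul_comm Complex.I]
  have hcont : ∀ {c : A} {g : ℂ → A}, IsEntireExtension α c g → Continuous fun t : ℝ => α t c :=
    fun hg => by simp_rw [← hg.2]; exact hg.1.continuous.comp Complex.continuous_ofReal
  -- The smoothed identity involves only real times, hence is norm continuous in the element and
  -- passes from D to its closure. The values at iβ could not be treated so: they need not converge
  -- when the elements do.
  have hsma : ∀ k : ℝ, 0 < k →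
      ∫ t : ℝ, Complex.exp (-k * (t - β * Complex.I) ^ 2) * ω (b * α t a) =
        ∫ t : ℝ, Complex.exp (-k * t ^ 2) * ω (α t a * b) := by
    intro k hk
    obtain ⟨c, hcD, hca⟩ := mem_closure_iff_seq_limit.1 (hD a)
    have hkr : 0 < ((k : ℝ) : ℂ).re := by simpa using hk
    have hbd : ∀ n, ∃ g, IsEntireExtension α (c n) g := fun n =>
      let ⟨g, hg, _⟩ := hkms (c n) (hcD n); ⟨g, hg⟩
    obtain ⟨C, hC⟩ : ∃ C, ∀ n, ‖c n‖ ≤ C := by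
      obtain ⟨C, hC⟩ := (Metric.isBounded_range_of_tendsto c hca).exists_norm_le
      exact ⟨C, fun n => hC _ ⟨n, rfl⟩⟩
    have hpt : ∀ t : ℝ, Tendsto (fun n => α t (c n)) atTop (𝓝 (α t a)) := fun t =>
      ((starAlgEquiv_continuous (α t)).tendsto a).comp hca
    have hca' : ∀ n, Continuous fun t : ℝ => α t (c n) := fun n =>
      let ⟨_, hg⟩ := hbd n; hcont hg
    have h₁ : Tendsto (fun n => ∫ t : ℝ, Complex.exp (-k * (t - β * Complex.I) ^ 2) *
        ω (b * α t (c n))) atTop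
        (𝓝 (∫ t : ℝ, Complex.exp (-k * (t - β * Complex.I) ^ 2) * ω (b * α t a))) := by
      have hi : Integrable fun t : ℝ => Complex.exp (-k * (t - β * Complex.I) ^ 2) := by
        have := GaussianFourier.integrable_cexp_neg_mul_sq_add_real_mul_I hkr (-β)
        simpa [sub_eq_add_neg] using this
      refine tendsto_integral_of_dominated_convergence _
        (fun n => by have := hca' n; fun_prop) (hi.norm.mul_const (‖ω‖ * (‖b‖ * C)))
        (fun n => Eventually.of_forall fun t => ?_) (Eventually.of_forall fun t => ?_)
      · rw [norm_mul]
        gcongr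
        refine (ω.le_opNorm _).trans ?_
        gcongr
        refine (norm_mul_le _ _).trans ?_
        gcongr
        rw [starAlgEquiv_norm]
        exact hC n
      · exact ((ω.continuous.tendsto _).comp ((hpt t).const_mul b)).const_mul _
    have h₂ : Tendsto (fun n => ∫ t : ℝ, Complex.exp (-k * t ^ 2) * ω (α t (c n) * b)) atTop
        (𝓝 (∫ t : ℝ, Complex.exp (-k * t ^ 2) * ω (α t a * b))) := by
      have hi : Integrable fun t : ℝ => Complex.exp (-k * t ^ 2) :=
        integrable_cexp_neg_mul_sq hkr
      refine tendsto_integral_of_dominated_convergence _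
        (fun n => by have := hca' n; fun_prop) (hi.norm.mul_const (‖ω‖ * (C * ‖b‖)))
        (fun n => Eventually.of_forall fun t => ?_) (Eventually.of_forall fun t => ?_)
      · rw [norm_mul]
        gcongr
        refine (ω.le_opNorm _).trans ?_
        gcongr
        refine (norm_mul_le _ _).trans ?_
        gcongr
        rw [starAlgEquiv_norm]
        exact hC n
      · exact ((ω.continuous.tendsto _).comp ((hpt t).mul_const b)).const_mul _
    simp_rw [fun n => hsm (c n) (hcD n) k hk] at h₁
    exact tendsto_nhds_unique h₁ h₂
  -- remove the smoothing
  obtain ⟨B, hB⟩ := hf.exists_bound hα β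
  have hBb : ∀ t : ℝ, ‖ω (b * f (t + β * Complex.I))‖ ≤ ‖ω‖ * (‖b‖ * B) := fun t => by
    refine (ω.le_opNorm _).trans ?_
    gcongr
    refine (norm_mul_le _ _).trans ?_
    gcongr
    exact hB t β Set.right_mem_uIcc
  have hBa : ∀ t : ℝ, ‖ω (α t a * b)‖ ≤ ‖ω‖ * (‖a‖ * ‖b‖) := fun t => by
    refine (ω.le_opNorm _).trans ?_
    gcongr
    refine (norm_mul_le _ _).trans ?_
    rw [starAlgEquiv_norm]
  have hc₁ : Continuous fun t : ℝ => ω (α t a * b) := by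
    have := hcont hf
    fun_prop
  have hc₂ : Continuous fun t : ℝ => ω (b * f (t + β * Complex.I)) := by
    have := hf.1.continuous
    fun_prop
  have hzero := eq_zero_of_integral_gaussian_mul_eq_zero
    (u := fun t => ω (α t a * b) - ω (b * f (t + β * Complex.I))) (hc₁.sub hc₂)
    (fun t => (norm_sub_le _ _).trans (add_le_add (hBa t) (hBb t))) fun k hk => by
      have hkr : 0 < ((k : ℝ) : ℂ).re := by simpa using hk
      have hi : Integrable fun t : ℝ => Complex.exp (-k * t ^ 2) := integrable_cexp_neg_mul_sq hkr
      simp_rw [mul_sub]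
      rw [integral_sub, ← hsma k hk, hshift hf k hk, sub_self]
      · exact hi.mul_bdd (c := ‖ω‖ * (‖a‖ * ‖b‖)) hc₁.aestronglyMeasurable
          (Eventually.of_forall hBa)
      · exact hi.mul_bdd (c := ‖ω‖ * (‖b‖ * B)) hc₂.aestronglyMeasurable
          (Eventually.of_forall hBb)
  have ha0 : α 0 a = a := by
    have h := hα 0 0 a
    rw [add_zero] at h
    exact ((α 0).injective h).symm
  have := sub_eq_zero.1 hzero
  rw [ha0] at this
  simpa [mul_comm] using this

end KMS

/-! ### Uniform equidistribution of irrational rotations -/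

section Equidistribution

theorem fourier_add_right (k : ℤ) (y b : UnitAddCircle) :
    (fourier k (y + b) : ℂ) = fourier k y * fourier k b := by
  simp only [fourier_apply, smul_add, AddCircle.toCircle_add, Circle.coe_mul]

theorem fourier_nsmul (k : ℤ) (n : ℕ) (b : UnitAddCircle) :
    (fourier k (n • b) : ℂ) = fourier k b ^ n := by
  simp only [fourier_apply, smul_comm k n b, AddCircle.toCircle_nsmul, Circle.coe_pow]

theorem norm_fourier_apply (k : ℤ) (y : UnitAddCircle) : ‖(fourier k y : ℂ)‖ = 1 := by
  rw [fourier_apply]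
  exact Circle.norm_coe _

theorem fourier_irrational_ne_one {α : ℝ} (hα : Irrational α) {k : ℤ} (hk : k ≠ 0) :
    (fourier k (α : UnitAddCircle) : ℂ) ≠ 1 := by
  rw [fourier_coe_apply]
  intro h
  obtain ⟨m, hm⟩ := Complex.exp_eq_one_iff.1 h
  have h₁ : (k : ℂ) * α = m := by
    have := Complex.two_pi_I_ne_zero
    apply mul_left_cancel₀ this
    rw [mul_comm _ (m : ℂ), ← hm]
    push_cast
    ring
  have h₂ : (k : ℝ) * α = m := by exact_mod_cast h₁
  exact (hα.intCast_mul hk).ne_int m h₂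

theorem norm_integral_circle_le (G : C(UnitAddCircle, ℂ)) :
    ‖∫ x : UnitAddCircle, G x‖ ≤ ‖G‖ := by
  have := norm_integral_le_of_norm_le_const (μ := (volume : Measure UnitAddCircle))
    (Eventually.of_forall G.norm_coe_le_norm)
  simpa [Measure.real] using this

/-- Rotating by `α` preserves the integral but multiplies it by a number other than 1. -/
theorem integral_fourier_eq_zero {α : ℝ} (hα : Irrational α) {k : ℤ} (hk : k ≠ 0) :
    ∫ x : UnitAddCircle, (fourier k x : ℂ) = 0 := by
  have h := integral_add_right_eq_self (μ := (volume : Measure UnitAddCircle))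
    (fun x => (fourier k x : ℂ)) (α : UnitAddCircle)
  simp_rw [fourier_add_right] at h
  rw [integral_mul_const] at h
  have h' : (∫ x : UnitAddCircle, (fourier k x : ℂ)) *
      ((fourier k (α : UnitAddCircle) : ℂ) - 1) = 0 := by rw [mul_sub, h, mul_one, sub_self]
  exact (mul_eq_zero.1 h').resolve_right (sub_ne_zero.2 (fourier_irrational_ne_one hα hk))

theorem integrable_circle {E : Type*} [NormedAddCommGroup E] [NormedSpace ℝ E]
    (G : C(UnitAddCircle, E)) : Integrable (fun x => G x) (volume : Measure UnitAddCircle) :=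
  G.continuous.integrable_of_hasCompactSupport
    (HasCompactSupport.of_compactSpace _)

/-- Uniform equidistribution of irrational rotations, for complex-valued functions. -/
theorem eventually_norm_sum_sub_integral_le {α : ℝ} (hα : Irrational α)
    (G : C(UnitAddCircle, ℂ)) {ε : ℝ} (hε : 0 < ε) :
    ∀ᶠ n : ℕ in atTop, ∀ y : UnitAddCircle,
      ‖∑ i ∈ Finset.range n, G (y + i • (α : UnitAddCircle)) - n * ∫ x, G x‖ ≤ ε * n := by
  have hP : ∀ P ∈ Submodule.span ℂ (Set.range (fourier (T := 1))), ∀ ε : ℝ, 0 < ε →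
      ∀ᶠ n : ℕ in atTop, ∀ y : UnitAddCircle,
        ‖∑ i ∈ Finset.range n, P (y + i • (α : UnitAddCircle)) - n * ∫ x, P x‖ ≤ ε * n := by
    intro P hP
    induction hP using Submodule.span_induction with
    | mem P hP =>
      obtain ⟨k, rfl⟩ := hP
      intro ε hε
      by_cases hk : k = 0
      · subst hk
        refine Eventually.of_forall fun n y => ?_
        simp [Measure.real]
        positivity
      · set c : ℂ := fourier k (α : UnitAddCircle) with hc
        have hc1 : c ≠ 1 := fourier_irrational_ne_one hα hk
        have hcn : ‖c‖ = 1 := norm_fourier_apply _ _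
        -- The geometric sum of powers of c is at most 2 / ‖c - 1‖ for every n, which is below ε n
        -- from N on.
        obtain ⟨N, hN⟩ := exists_nat_gt (2 / ‖c - 1‖ / ε)
        filter_upwards [eventually_ge_atTop N] with n hn y
        rw [integral_fourier_eq_zero hα hk, mul_zero, sub_zero]
        simp_rw [fourier_add_right, fourier_nsmul, ← Finset.mul_sum]
        rw [geom_sum_eq hc1, norm_mul, norm_div]
        have h₁ : ‖(fourier k y : ℂ)‖ = 1 := norm_fourier_apply _ _
        have h₂ : ‖c ^ n - 1‖ ≤ 2 := by
          refine (norm_sub_le _ _).trans ?_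
          simp [hcn]
          norm_num
        rw [h₁, one_mul]
        have h₃ : 2 / ‖c - 1‖ / ε < n := hN.trans_le (by exact_mod_cast hn)
        rw [div_lt_iff₀ hε] at h₃
        calc _ ≤ 2 / ‖c - 1‖ := by gcongr
          _ ≤ _ := by linarith
    | zero =>
      intro ε hε
      refine Eventually.of_forall fun n y => ?_
      simp
      positivity
    | add P Q _ _ hP hQ =>
      intro ε hε
      filter_upwards [hP (ε / 2) (half_pos hε), hQ (ε / 2) (half_pos hε)] with n h₁ h₂ y
      simp only [ContinuousMap.add_apply, Finset.sum_add_distrib]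
      rw [integral_add (integrable_circle P) (integrable_circle Q), mul_add, add_sub_add_comm]
      refine (norm_add_le _ _).trans ?_
      linarith [h₁ y, h₂ y]
    | smul z P _ hP =>
      intro ε hε
      have hz : 0 < ‖z‖ + 1 := by positivity
      filter_upwards [hP (ε / (‖z‖ + 1)) (div_pos hε hz)] with n h₁ y
      simp only [ContinuousMap.smul_apply, smul_eq_mul, ← Finset.mul_sum]
      rw [integral_const_mul, mul_left_comm, ← mul_sub, norm_mul]
      calc ‖z‖ * _ ≤ (‖z‖ + 1) * (ε / (‖z‖ + 1) * n) := by
            gcongr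
            · linarith
            · exact h₁ y
        _ = ε * n := by field_simp
  have hG : G ∈ (Submodule.span ℂ (Set.range (fourier (T := 1)))).topologicalClosure := by
    rw [span_fourier_closure_eq_top]; trivial
  obtain ⟨P, hPs, hPG⟩ := Metric.mem_closure_iff.1 hG (ε / 3) (by positivity)
  rw [dist_eq_norm] at hPG
  filter_upwards [hP P hPs (ε / 3) (by positivity)] with n hn y
  have h₁ : ‖∑ i ∈ Finset.range n, (G - P) (y + i • (α : UnitAddCircle))‖ ≤ n * (ε / 3) := by
    refine (norm_sum_le_of_le _ (fun i _ => ((G - P).norm_coe_le_norm _).trans hPG.le)).trans ?_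
    simp
  have h₂ : ‖(n : ℂ) * ∫ x, (G - P) x‖ ≤ n * (ε / 3) := by
    rw [norm_mul, Complex.norm_natCast]
    gcongr
    exact (norm_integral_circle_le _).trans hPG.le
  have h₃ : ∑ i ∈ Finset.range n, G (y + i • (α : UnitAddCircle)) - n * ∫ x, G x =
      (∑ i ∈ Finset.range n, P (y + i • (α : UnitAddCircle)) - n * ∫ x, P x) +
      (∑ i ∈ Finset.range n, (G - P) (y + i • (α : UnitAddCircle)) - n * ∫ x, (G - P) x) := by
    simp only [ContinuousMap.sub_apply, Finset.sum_sub_distrib]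
    rw [integral_sub (integrable_circle G) (integrable_circle P)]
    ring
  rw [h₃]
  refine (norm_add_le _ _).trans ?_
  have := norm_sub_le (∑ i ∈ Finset.range n, (G - P) (y + i • (α : UnitAddCircle)))
    (n * ∫ x, (G - P) x)
  linarith [hn y]

/-- Uniform equidistribution of irrational rotations, for real-valued functions. -/
theorem eventually_abs_sum_sub_integral_le {α : ℝ} (hα : Irrational α)
    (G : C(UnitAddCircle, ℝ)) {ε : ℝ} (hε : 0 < ε) :
    ∀ᶠ n : ℕ in atTop, ∀ y : UnitAddCircle,
      |∑ i ∈ Finset.range n, G (y + i • (α : UnitAddCircle)) - n * ∫ x, G x| ≤ ε * n := by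
  filter_upwards [eventually_norm_sum_sub_integral_le hα
    ((⟨Complex.ofReal, Complex.continuous_ofReal⟩ : C(ℝ, ℂ)).comp G) hε] with n hn y
  have h := hn y
  simp only [ContinuousMap.comp_apply, ContinuousMap.coe_mk] at h
  rw [integral_complex_ofReal] at h
  rw [← Real.norm_eq_abs, ← Complex.norm_real]
  push_cast
  exact h

end Equidistribution

/-! ### Conformal functionals and the vanishing of the mean -/

section Conformal

/-- The function `y ↦ g (y + b)`. -/
noncomputable def translateMap (b : UnitAddCircle) (g : C(UnitAddCircle, ℝ)) :
    C(UnitAddCircle, ℝ) :=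
  ⟨fun y => g (y + b), by fun_prop⟩

/-- The function `y ↦ exp (W y)`. -/
noncomputable def expMap (W : C(UnitAddCircle, ℝ)) : C(UnitAddCircle, ℝ) :=
  ⟨fun y => Real.exp (W y), by fun_prop⟩

/-- The Birkhoff sum `y ↦ ∑ i < n, W (y + i a)`. -/
noncomputable def rotSum (a : UnitAddCircle) (W : C(UnitAddCircle, ℝ)) (n : ℕ) :
    C(UnitAddCircle, ℝ) :=
  ⟨fun y => ∑ i ∈ Finset.range n, W (y + i • a), by fun_prop⟩

@[simp] theorem translateMap_apply (b : UnitAddCircle) (g : C(UnitAddCircle, ℝ)) (y) :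
    translateMap b g y = g (y + b) := rfl

@[simp] theorem expMap_apply (W : C(UnitAddCircle, ℝ)) (y) : expMap W y = Real.exp (W y) := rfl

@[simp] theorem rotSum_apply (a : UnitAddCircle) (W : C(UnitAddCircle, ℝ)) (n : ℕ) (y) :
    rotSum a W n y = ∑ i ∈ Finset.range n, W (y + i • a) := rfl

/-- `M` is a normalised positive functional whose image under the inverse of the rotation by `a`
is `exp W · M`. -/
structure IsConformal (a : UnitAddCircle) (W : C(UnitAddCircle, ℝ))
    (M : C(UnitAddCircle, ℝ) →ₗ[ℝ] ℝ) : Prop where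
  nonneg : ∀ g, (∀ y, 0 ≤ g y) → 0 ≤ M g
  map_one : M 1 = 1
  map_translate : ∀ g, M (translateMap (-a) g) = M (expMap W * g)

namespace IsConformal

variable {a : UnitAddCircle} {W : C(UnitAddCircle, ℝ)} {M : C(UnitAddCircle, ℝ) →ₗ[ℝ] ℝ}

theorem mono (hM : IsConformal a W M) {f g : C(UnitAddCircle, ℝ)} (h : ∀ y, f y ≤ g y) :
    M f ≤ M g := by
  have := hM.nonneg (g - f) fun y => by simpa using h y
  rw [map_sub] at this
  linarith

theorem map_const (hM : IsConformal a W M) (c : ℝ) :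
    M (ContinuousMap.const _ c) = c := by
  have : (ContinuousMap.const UnitAddCircle c : C(UnitAddCircle, ℝ)) = c • 1 := by ext; simp
  rw [this, map_smul, hM.map_one, smul_eq_mul, mul_one]

/-- Cocycle identity: moving the weight past n translations turns W into its translate by n a, the
next term of the Birkhoff sum. -/
theorem map_translate_nsmul (hM : IsConformal a W M) (n : ℕ) (g : C(UnitAddCircle, ℝ)) :
    M (translateMap (-(n • a)) g) = M (expMap (rotSum a W n) * g) := by
  induction n generalizing g with
  | zero => congr 1; ext y; simp
  | succ n ih =>
    have h₁ : translateMap (-((n + 1) • a)) g = translateMap (-a) (translateMap (-(n • a)) g) := by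
      ext y
      simp only [translateMap_apply]
      congr 1
      rw [succ_nsmul]
      abel
    have h₂ : expMap W * translateMap (-(n • a)) g =
        translateMap (-(n • a)) (expMap (translateMap (n • a) W) * g) := by
      ext y; simp
    have h₃ : expMap (rotSum a W n) * (expMap (translateMap (n • a) W) * g) =
        expMap (rotSum a W (n + 1)) * g := by
      ext y
      simp only [ContinuousMap.mul_apply, expMap_apply, rotSum_apply, translateMap_apply,
        Finset.sum_range_succ, Real.exp_add, mul_assoc]
    rw [h₁, hM.map_translate, h₂, ih, h₃]

theorem map_exp_rotSum (hM : IsConformal a W M) (n : ℕ) : M (expMap (rotSum a W n)) = 1 := by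
  have h := hM.map_translate_nsmul n 1
  rw [mul_one] at h
  exact h.symm.trans hM.map_one

/-- A conformal functional for an irrational rotation can only exist if `∫ W = 0`. -/
theorem integral_eq_zero {α : ℝ} (hα : Irrational α)
    (hM : IsConformal (α : UnitAddCircle) W M) : ∫ x, W x = 0 := by
  by_contra hI
  -- With error |I|/2 per step, S_n lies everywhere on one side of nI/2, so exp(S_n) is bounded away
  -- from 1 on one side, against M(exp S_n) = 1.
  obtain ⟨n, hn, hn1⟩ := ((eventually_abs_sum_sub_integral_le hα W
    (half_pos (abs_pos.2 hI))).and (eventually_ge_atTop 1)).exists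
  have hn0 : (0 : ℝ) < n := by exact_mod_cast hn1
  have hS := hM.map_exp_rotSum n
  set I := ∫ x, W x
  rcases lt_or_gt_of_ne hI with h | h
  · have h₁ : ∀ y, expMap (rotSum (α : UnitAddCircle) W n) y ≤
        ContinuousMap.const UnitAddCircle (Real.exp (n * I / 2)) y := fun y => by
      have := (abs_le.1 (hn y)).2
      rw [abs_of_neg h] at this
      simp only [expMap_apply, rotSum_apply, ContinuousMap.const_apply]
      gcongr
      linarith
    have h₂ := hM.mono h₁
    rw [hM.map_const, hS] at h₂
    have : Real.exp (n * I / 2) < 1 := Real.exp_lt_one_iff.2 (by nlinarith)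
    linarith
  · have h₁ : ∀ y, ContinuousMap.const UnitAddCircle (Real.exp (n * I / 2)) y ≤
        expMap (rotSum (α : UnitAddCircle) W n) y := fun y => by
      have := (abs_le.1 (hn y)).1
      rw [abs_of_pos h] at this
      simp only [expMap_apply, rotSum_apply, ContinuousMap.const_apply]
      gcongr
      linarith
    have h₂ := hM.mono h₁
    rw [hM.map_const, hS] at h₂
    have : 1 < Real.exp (n * I / 2) := Real.one_lt_exp_iff.2 (by positivity)
    linarith

end IsConformal

end Conformal

/-! ### Dirichlet approximations and the first q orbit points -/

section RationalApproximation

/-- `p / q` is a reduced fraction with `|α - p / q| ≤ 1 / q²`. -/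
structure IsDirichletApprox (α : ℝ) (p : ℤ) (q : ℕ) : Prop where
  pos : 0 < q
  coprime : IsCoprime (q : ℤ) p
  abs_sub_le : |α - p / q| ≤ 1 / q ^ 2

theorem exists_isDirichletApprox {α : ℝ} (hα : Irrational α) (N : ℕ) :
    ∃ p q, IsDirichletApprox α p q ∧ N ≤ q := by
  obtain ⟨ε, hε, hε0⟩ := ((hα.eventually_forall_le_dist_cast_rat_of_den_le N).filter_mono
    nhdsWithin_le_nhds |>.and (self_mem_nhdsWithin (s := Set.Ioi (0 : ℝ)))).exists
  have hε0 : 0 < ε := hε0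
  -- Fractions with denominator at most N stay at distance ε from α. A Dirichlet fraction for a
  -- bound m > 1/ε comes closer, so its denominator exceeds N.
  obtain ⟨m, hm⟩ := exists_nat_gt (1 / ε)
  have hm0 : 0 < m := by
    have : (0 : ℝ) < m := lt_trans (by positivity) hm
    exact_mod_cast this
  obtain ⟨r, hr, hrm⟩ := Real.exists_rat_abs_sub_le_and_den_le α hm0
  have hd : (0 : ℝ) < r.den := by exact_mod_cast r.pos
  have hrm' : (r.den : ℝ) ≤ m := by exact_mod_cast hrm
  refine ⟨r.num, r.den, ⟨r.pos, ?_, ?_⟩, ?_⟩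
  · have := r.reduced
    rw [isCoprime_comm]
    exact Int.isCoprime_iff_nat_coprime.2 (by simpa using this)
  · have : (r : ℝ) = r.num / r.den := Rat.cast_def r
    rw [← this]
    refine hr.trans ?_
    rw [pow_two]
    gcongr
    linarith
  · by_contra! h
    have h₁ := hε r h.le
    rw [Real.dist_eq] at h₁
    have h₂ : 1 / (((m : ℝ) + 1) * r.den) ≤ 1 / (m + 1) := by
      have : (1 : ℝ) ≤ r.den := by exact_mod_cast r.pos
      gcongr
      nlinarith
    have h₃ : 1 / ((m : ℝ) + 1) < ε := by
      rw [div_lt_comm₀ (by positivity) hε0]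
      linarith
    linarith

variable {α : ℝ} {p : ℤ} {q : ℕ}

theorem norm_coe_circle_le (t : ℝ) : ‖(t : UnitAddCircle)‖ ≤ |t| := by
  rw [UnitAddCircle.norm_eq]
  simpa using round_le t 0

theorem exists_coe_eq_abs_eq_norm (z : UnitAddCircle) :
    ∃ d : ℝ, (d : UnitAddCircle) = z ∧ |d| = ‖z‖ := by
  obtain ⟨t, rfl⟩ := QuotientAddGroup.mk_surjective z
  refine ⟨t - round t, ?_, UnitAddCircle.norm_eq.symm⟩
  have : ((round t : ℝ) : UnitAddCircle) = 0 := by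
    rw [AddCircle.coe_eq_zero_iff]
    exact ⟨round t, by simp⟩
  change ((t - round t : ℝ) : UnitAddCircle) = (t : UnitAddCircle)
  rw [AddCircle.coe_sub, this, sub_zero]

theorem coe_intCast_circle (m : ℤ) : ((m : ℝ) : UnitAddCircle) = 0 := by
  rw [AddCircle.coe_eq_zero_iff]
  exact ⟨m, by simp⟩

theorem coe_natCast_mul_circle (j : ℕ) (α : ℝ) :
    ((j * α : ℝ) : UnitAddCircle) = j • (α : UnitAddCircle) := by
  rw [← AddCircle.coe_nsmul, nsmul_eq_mul]

namespace IsDirichletApprox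

theorem pos_real (H : IsDirichletApprox α p q) : (0 : ℝ) < q := by exact_mod_cast H.pos

theorem abs_mul_sub_le (H : IsDirichletApprox α p q) {j : ℕ} (hj : j ≤ q) :
    |j * α - j * p / q| ≤ 1 / q := by
  have hq := H.pos_real
  have hj' : (j : ℝ) ≤ q := by exact_mod_cast hj
  have : (j * α - j * p / q : ℝ) = j * (α - p / q) := by ring
  rw [this, abs_mul, abs_of_nonneg (by positivity)]
  calc (j : ℝ) * |α - p / q| ≤ q * (1 / q ^ 2) := by
        gcongr
        exact H.abs_sub_le
    _ = 1 / q := by field_simp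

theorem eq_of_dvd (H : IsDirichletApprox α p q) {i j : ℕ} (hi : i < q) (hj : j < q)
    (h : (q : ℤ) ∣ i * p - j * p) : i = j := by
  rw [← sub_mul] at h
  have h₁ := H.coprime.dvd_of_dvd_mul_right h
  have h₂ : (i : ℤ) - j = 0 := Int.eq_zero_of_abs_lt_dvd h₁ (by rw [abs_lt]; omega)
  omega

theorem exists_dvd (H : IsDirichletApprox α p q) (m : ℤ) :
    ∃ j < q, (q : ℤ) ∣ m - (j : ℕ) * p := by
  have hq : (0 : ℤ) < q := by exact_mod_cast H.pos
  obtain ⟨u, v, huv⟩ := H.coprime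
  have h0 := Int.emod_nonneg (m * v) hq.ne'
  have h1 := Int.emod_lt_of_pos (m * v) hq
  refine ⟨((m * v) % q).toNat, by omega, ?_⟩
  rw [Int.toNat_of_nonneg h0]
  have h2 := Int.emod_add_mul_ediv (m * v) q
  refine ⟨m * u + p * ((m * v) / q), ?_⟩
  have h3 : (m * v) % q = m * v - q * ((m * v) / q) := by linarith
  rw [h3]
  linear_combination -m * huv

/-- Every point of the circle is close to one of the first `q` points of the orbit of `0`. -/
theorem exists_norm_sub_le (H : IsDirichletApprox α p q) (y : UnitAddCircle) :
    ∃ j < q, ‖y - j • (α : UnitAddCircle)‖ ≤ 3 / (2 * q) := by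
  have hq := H.pos_real
  obtain ⟨t, rfl⟩ := QuotientAddGroup.mk_surjective y
  -- Rounding t to a multiple of 1/q costs 1/(2q), and replacing jp/q by jα costs 1/q more.
  obtain ⟨j, hj, k, hk⟩ := H.exists_dvd (round (t * q))
  refine ⟨j, hj, ?_⟩
  have hk' : (round (t * q) : ℝ) = j * p + q * k := by
    have : (round (t * q) : ℤ) = j * p + q * k := by linarith
    exact_mod_cast this
  have h₁ : (t : UnitAddCircle) - j • (α : UnitAddCircle) = ((t - j * α - k : ℝ) : UnitAddCircle) := by
    rw [AddCircle.coe_sub, AddCircle.coe_sub, coe_intCast_circle, sub_zero, coe_natCast_mul_circle]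
  change ‖(t : UnitAddCircle) - j • (α : UnitAddCircle)‖ ≤ _
  rw [h₁]
  refine (norm_coe_circle_le _).trans ?_
  have h₂ := abs_sub_round (t * q)
  have h₃ := H.abs_mul_sub_le hj.le
  have h₄ : t - j * α - k = (t * q - round (t * q)) / q - (j * α - j * p / q) := by
    rw [hk']; field_simp; ring
  rw [h₄]
  refine (abs_sub _ _).trans ?_
  rw [abs_div, abs_of_pos hq]
  calc _ ≤ 1 / 2 / (q : ℝ) + 1 / q := by gcongr
    _ = _ := by field_simp; norm_num

/-- At most seven of the first `q` points of the orbit of `0` are within `2 / q` of a given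
point. -/
theorem card_filter_norm_sub_lt (H : IsDirichletApprox α p q) (y : UnitAddCircle) :
    ((Finset.range q).filter fun j => ‖y - j • (α : UnitAddCircle)‖ < 2 / q).card ≤ 7 := by
  have hq := H.pos_real
  obtain ⟨t, rfl⟩ := QuotientAddGroup.mk_surjective y
  -- Each such j yields an integer m congruent to jp modulo q and within 3 of tq. Distinct j give
  -- distinct residues, so counting the possible m suffices.
  have h : ∀ j ∈ (Finset.range q).filter fun j =>
      ‖(t : UnitAddCircle) - j • (α : UnitAddCircle)‖ < 2 / q,
      ∃ m : ℤ, |t * q - m| < 3 ∧ (q : ℤ) ∣ m - j * p := by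
    intro j hj
    rw [Finset.mem_filter, Finset.mem_range] at hj
    have h₁ : (t : UnitAddCircle) - j • (α : UnitAddCircle) = ((t - j * α : ℝ) : UnitAddCircle) := by
      rw [AddCircle.coe_sub, coe_natCast_mul_circle]
    obtain ⟨hj, h₂⟩ := hj
    rw [h₁, UnitAddCircle.norm_eq] at h₂
    set k := round (t - j * α)
    refine ⟨j * p + q * k, ?_, ⟨k, by ring⟩⟩
    have h₃ := H.abs_mul_sub_le hj.le
    push_cast
    have h₄ : t * q - (j * p + q * k) = ((t - j * α - k) + (j * α - j * p / q)) * q := by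
      field_simp; ring
    rw [h₄, abs_mul, abs_of_pos hq]
    have h₅ := abs_add_le (t - j * α - k) (j * α - j * p / q)
    calc _ < (2 / q + 1 / q : ℝ) * q := by gcongr; linarith
      _ = 3 := by field_simp; norm_num
  choose! m hm hmd using h
  have hinj : Set.InjOn m ((Finset.range q).filter fun j =>
      ‖(t : UnitAddCircle) - j • (α : UnitAddCircle)‖ < 2 / q) := by
    intro i hi j hj hij
    rw [Finset.mem_coe] at hi hj
    refine H.eq_of_dvd (Finset.mem_range.1 (Finset.mem_filter.1 hi).1)
      (Finset.mem_range.1 (Finset.mem_filter.1 hj).1) ?_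
    have := dvd_sub (hmd j hj) (hmd i hi)
    rw [hij] at this
    simpa using this
  have hmaps : Set.MapsTo m ((Finset.range q).filter fun j =>
      ‖(t : UnitAddCircle) - j • (α : UnitAddCircle)‖ < 2 / q)
      (Finset.Icc (⌊t * q⌋ - 3) (⌊t * q⌋ + 3)) := by
    intro j hj
    have h₁ := abs_lt.1 (hm j hj)
    have h₂ := Int.floor_le (t * q)
    have h₃ := Int.lt_floor_add_one (t * q)
    rw [Finset.coe_Icc, Set.mem_Icc]
    constructor
    · have : (⌊t * q⌋ : ℝ) < m j + 3 := by linarith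
      have : ⌊t * q⌋ < m j + 3 := by exact_mod_cast this
      omega
    · have : (m j : ℝ) < ⌊t * q⌋ + 4 := by linarith
      have : m j < ⌊t * q⌋ + 4 := by exact_mod_cast this
      omega
  have := Finset.card_le_card_of_injOn m hmaps hinj
  refine this.trans ?_
  rw [Int.card_Icc]
  omega

/-- By coprimality the residues of ip, i < n ≤ q, are distinct, so the left side is a partial sum of
the right. -/
theorem sum_mod_le (H : IsDirichletApprox α p q) {f : ℤ → ℝ} (hf : ∀ r, 0 ≤ f r) {n : ℕ}
    (hn : n ≤ q) :
    ∑ i ∈ Finset.range n, f ((i * p) % q) ≤ ∑ r ∈ Finset.range q, f r := by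
  have hq : (0 : ℤ) < q := by exact_mod_cast H.pos
  have hinj : Set.InjOn (fun i : ℕ => (((i : ℤ) * p) % q).toNat) (Finset.range n) := by
    intro i hi j hj hij
    simp only [Finset.coe_range, Set.mem_Iio] at hi hj
    refine H.eq_of_dvd (hi.trans_le hn) (hj.trans_le hn) ?_
    have h₁ := Int.emod_nonneg ((i : ℤ) * p) hq.ne'
    have h₂ := Int.emod_nonneg ((j : ℤ) * p) hq.ne'
    exact Int.ModEq.dvd (show (j : ℤ) * p % q = i * p % q by dsimp only at hij; omega)
  calc ∑ i ∈ Finset.range n, f ((i * p) % q)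
      = ∑ i ∈ Finset.range n, f (((((i : ℤ) * p) % q).toNat : ℕ) : ℤ) := by
        refine Finset.sum_congr rfl fun i _ => ?_
        rw [Int.toNat_of_nonneg (Int.emod_nonneg _ hq.ne')]
    _ = ∑ r ∈ (Finset.range n).image fun i : ℕ => (((i : ℤ) * p) % q).toNat, f r :=
        (Finset.sum_image (f := fun r : ℕ => f r) hinj).symm
    _ ≤ _ := by
        refine Finset.sum_le_sum_of_subset_of_nonneg ?_ fun r _ _ => hf r
        intro r hr
        obtain ⟨i, -, rfl⟩ := Finset.mem_image.1 hr
        have h₁ := Int.emod_lt_of_pos ((i : ℤ) * p) hq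
        rw [Finset.mem_range]
        omega

end IsDirichletApprox

end RationalApproximation

/-! ### The Denjoy–Koksma distortion bound -/

section Distortion

/-- `v` is a monotone function whose increments dominate those of `W`. -/
structure IsVariationBound (W : C(UnitAddCircle, ℝ)) (v : ℝ → ℝ) : Prop where
  mono : Monotone v
  abs_sub_le : ∀ s t : ℝ, s ≤ t → |W (t : UnitAddCircle) - W (s : UnitAddCircle)| ≤ v t - v s

theorem IsVariationBound.abs_sub_le_of_mem {W : C(UnitAddCircle, ℝ)} {v : ℝ → ℝ}
    (hv : IsVariationBound W v) {s t l r : ℝ} (hs : s ∈ Set.Icc l r) (ht : t ∈ Set.Icc l r) :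
    |W (t : UnitAddCircle) - W (s : UnitAddCircle)| ≤ v r - v l := by
  rcases le_total s t with h | h
  · linarith [hv.abs_sub_le s t h, hv.mono hs.1, hv.mono ht.2]
  · rw [abs_sub_comm]
    linarith [hv.abs_sub_le t s h, hv.mono ht.1, hv.mono hs.2]

/-- A window of length 6/q splits into six cells of length 1/q. For each fixed cell index the sum
over r telescopes inside [-3, 5]. -/
theorem sum_window_le {v : ℝ → ℝ} (hv : Monotone v) {q : ℕ} (hq : 0 < q) {s : ℝ} (h0 : 0 ≤ s)
    (h1 : s ≤ 1) :
    ∑ r ∈ Finset.range q, (v (s + (r + 3) / q) - v (s + (r - 3) / q)) ≤ 6 * (v 5 - v (-3)) := by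
  have hq1 : (1 : ℝ) ≤ q := by exact_mod_cast hq
  have hq' : (0 : ℝ) < q := by linarith
  have h : ∀ r : ℕ, v (s + (r + 3) / q) - v (s + (r - 3) / q) =
      ∑ k ∈ Finset.range 6, (v (s + (((r + 1 : ℕ) : ℝ) + k - 3) / q) - v (s + (r + k - 3) / q)) := by
    intro r
    have := Finset.sum_range_sub (fun k : ℕ => v (s + ((r : ℝ) + k - 3) / q)) 6
    simp only [Nat.cast_zero, add_zero] at this
    rw [show ((r : ℝ) + ((6 : ℕ) : ℝ) - 3) = r + 3 by push_cast; ring] at this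
    rw [← this]
    refine Finset.sum_congr rfl fun k _ => ?_
    push_cast
    congr 4
    ring
  simp_rw [h]
  rw [Finset.sum_comm]
  have h' : ∀ k ∈ Finset.range 6, ∑ r ∈ Finset.range q,
      (v (s + (((r + 1 : ℕ) : ℝ) + k - 3) / q) - v (s + (r + k - 3) / q)) ≤ v 5 - v (-3) := by
    intro k hk
    have hk : k < 6 := Finset.mem_range.1 hk
    have hk6 : (k : ℝ) ≤ 5 := by exact_mod_cast Nat.le_of_lt_succ hk
    have hk0 : (0 : ℝ) ≤ k := by positivity
    rw [Finset.sum_range_sub (fun r : ℕ => v (s + ((r : ℝ) + k - 3) / q)) q]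
    have h₁ : s + ((q : ℝ) + k - 3) / q ≤ 5 := by
      have : ((q : ℝ) + k - 3) / q ≤ 4 := by
        rw [div_le_iff₀ hq']; linarith
      linarith
    have h₂ : -3 ≤ s + (((0 : ℕ) : ℝ) + k - 3) / q := by
      have : -3 ≤ (((0 : ℕ) : ℝ) + k - 3) / q := by
        rw [le_div_iff₀ hq']; push_cast; linarith
      linarith
    linarith [hv h₁, hv h₂]
  refine (Finset.sum_le_sum h').trans ?_
  rw [Finset.sum_const, Finset.card_range, nsmul_eq_mul]
  norm_num

/-- Bounded distortion of Birkhoff sums, after Denjoy and Koksma. -/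
theorem IsDirichletApprox.abs_rotSum_sub_le {α : ℝ} {p : ℤ} {q : ℕ} (H : IsDirichletApprox α p q)
    {W : C(UnitAddCircle, ℝ)} {v : ℝ → ℝ} (hv : IsVariationBound W v) {n : ℕ} (hn : n ≤ q)
    {x y : UnitAddCircle} (hxy : ‖y - x‖ ≤ 2 / q) :
    |rotSum α W n y - rotSum α W n x| ≤ 6 * (v 5 - v (-3)) := by
  have hq := H.pos_real
  have hqz : (0 : ℤ) < q := by exact_mod_cast H.pos
  obtain ⟨d, hd, hdn⟩ := exists_coe_eq_abs_eq_norm (y - x)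
  obtain ⟨s, hs0, hs1, rfl⟩ : ∃ s : ℝ, 0 ≤ s ∧ s ≤ 1 ∧ (s : UnitAddCircle) = x := by
    obtain ⟨t, rfl⟩ := QuotientAddGroup.mk_surjective x
    refine ⟨Int.fract t, Int.fract_nonneg t, (Int.fract_lt_one t).le, ?_⟩
    rw [Int.fract, AddCircle.coe_sub, coe_intCast_circle, sub_zero]
  have hy : y = ((s + d : ℝ) : UnitAddCircle) := by
    rw [AddCircle.coe_add, hd]; abel
  rw [hy]
  rw [← hdn] at hxy
  have hd' := abs_le.1 hxy
  simp only [rotSum_apply, ← Finset.sum_sub_distrib]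
  refine (Finset.abs_sum_le_sum_abs _ _).trans ?_
  refine le_trans ?_ (sum_window_le hv.mono H.pos hs0 hs1)
  refine le_trans (Finset.sum_le_sum fun i hi => ?_) (H.sum_mod_le
    (f := fun r => v (s + (r + 3) / q) - v (s + (r - 3) / q)) (fun r => ?_) hn)
  · have hi : i < q := (Finset.mem_range.1 hi).trans_le hn
    obtain ⟨hδ₁, hδ₂⟩ := abs_le.1 (H.abs_mul_sub_le hi.le)
    -- Modulo 1, x + iα is within 1/q of s + r/q and y + iα is within 2/q of x + iα, so both lie in
    -- the window of half-width 3/q around s + r/q.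
    set r : ℤ := (i * p) % q with hr
    have hrd : ((i : ℝ) * p) = r + q * (((i * p) / q : ℤ) : ℝ) := by
      have := Int.emod_add_mul_ediv ((i : ℤ) * p) q
      rw [← hr] at this
      exact_mod_cast this.symm
    set k : ℤ := (i * p) / q
    set δ : ℝ := i * α - i * p / q with hδ
    have hiα : (i : ℝ) * α = r / q + δ + k := by
      rw [hδ, hrd]; field_simp; ring
    have hpt : ∀ u : ℝ, (u : UnitAddCircle) + i • (α : UnitAddCircle) =
        ((u + r / q + δ : ℝ) : UnitAddCircle) := by
      intro u
      rw [← coe_natCast_mul_circle, hiα]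
      simp only [AddCircle.coe_add, coe_intCast_circle, add_zero, add_assoc]
    rw [hpt, hpt]
    have e₁ : ((r : ℝ) + 3) / q = r / q + 1 / q + 2 / q := by ring
    have e₂ : ((r : ℝ) - 3) / q = r / q - 1 / q - 2 / q := by ring
    have hp : (0 : ℝ) < 2 / q := by positivity
    refine hv.abs_sub_le_of_mem ?_ ?_ <;> rw [e₁, e₂] <;> constructor <;> linarith
  · refine sub_nonneg.2 (hv.mono ?_)
    gcongr
    linarith

end Distortion

/-! ### Comparison and uniqueness of conformal functionals -/

section Comparison

/-- The tent function of half-width `2 / q` centred at `x`. -/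
noncomputable def tent (q : ℕ) (x : UnitAddCircle) : C(UnitAddCircle, ℝ) :=
  ⟨fun y => max 0 (1 - q / 2 * ‖y - x‖), by fun_prop⟩

theorem tent_apply (q : ℕ) (x y : UnitAddCircle) :
    tent q x y = max 0 (1 - q / 2 * ‖y - x‖) := rfl

theorem tent_nonneg (q : ℕ) (x y : UnitAddCircle) : 0 ≤ tent q x y := le_max_left _ _

theorem tent_le_one (q : ℕ) (x y : UnitAddCircle) : tent q x y ≤ 1 :=
  max_le zero_le_one (sub_le_self _ (by positivity))

theorem tent_eq_zero {q : ℕ} (hq : 0 < q) {x y : UnitAddCircle} (h : 2 / q ≤ ‖y - x‖) :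
    tent q x y = 0 := by
  have hq : (0 : ℝ) < q := by exact_mod_cast hq
  refine max_eq_left ?_
  rw [div_le_iff₀ hq] at h
  linarith

variable {α : ℝ} {p : ℤ} {q : ℕ} {W : C(UnitAddCircle, ℝ)}

theorem IsDirichletApprox.le_sum_tent (H : IsDirichletApprox α p q) (y : UnitAddCircle) :
    1 / 4 ≤ ∑ j ∈ Finset.range q, tent q (j • (α : UnitAddCircle)) y := by
  have hq := H.pos_real
  obtain ⟨j, hj, h⟩ := H.exists_norm_sub_le y
  refine le_trans ?_ (Finset.single_le_sum
    (f := fun j : ℕ => tent q (j • (α : UnitAddCircle)) y) (fun i _ => tent_nonneg q _ y)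
    (Finset.mem_range.2 hj))
  refine le_max_of_le_right ?_
  have : (q : ℝ) / 2 * ‖y - j • (α : UnitAddCircle)‖ ≤ q / 2 * (3 / (2 * q)) := by gcongr
  have e : (q : ℝ) / 2 * (3 / (2 * q)) = 3 / 4 := by field_simp; norm_num
  linarith

theorem IsDirichletApprox.sum_tent_le (H : IsDirichletApprox α p q) (y : UnitAddCircle) :
    ∑ j ∈ Finset.range q, tent q (j • (α : UnitAddCircle)) y ≤ 7 := by
  calc ∑ j ∈ Finset.range q, tent q (j • (α : UnitAddCircle)) y
      ≤ ∑ j ∈ Finset.range q, if ‖y - j • (α : UnitAddCircle)‖ < 2 / q then (1 : ℝ) else 0 := by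
        refine Finset.sum_le_sum fun j _ => ?_
        split_ifs with h
        · exact tent_le_one _ _ _
        · exact (tent_eq_zero H.pos (not_lt.1 h)).le
    _ = (((Finset.range q).filter fun j => ‖y - j • (α : UnitAddCircle)‖ < 2 / q).card : ℝ) := by
        rw [Finset.sum_ite, Finset.sum_const_zero, add_zero, Finset.sum_const, nsmul_eq_mul,
          mul_one]
    _ ≤ 7 := by exact_mod_cast H.card_filter_norm_sub_lt y

/-- Swapping centre and translation turns the orbit translates of one tent into the tents at the
orbit of 0, for which the covering bounds 1/4 and 7 hold. -/
theorem translateMap_tent (a x : UnitAddCircle) (y : UnitAddCircle) :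
    translateMap (-a) (tent q x) y = tent q a (y - x) := by
  rw [translateMap_apply, tent_apply, tent_apply]
  congr 4
  abel

namespace IsConformal

variable {M M₁ M₂ : C(UnitAddCircle, ℝ) →ₗ[ℝ] ℝ} {v : ℝ → ℝ}

/-- The translates of the tent by jα, j < q, sum to between 1/4 and 7, and by conformality their
masses are M(exp(S_j) · tent). On the support of the tent bounded distortion replaces S_j by S_j(x),
so M(tent) is known up to constants in terms of W alone. -/
theorem tent_bounds (hM : IsConformal α W M) (H : IsDirichletApprox α p q)
    (hv : IsVariationBound W v) (x : UnitAddCircle) :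
    1 / 4 ≤ Real.exp (6 * (v 5 - v (-3))) * (∑ j ∈ Finset.range q, Real.exp (rotSum α W j x)) *
      M (tent q x) ∧
    (∑ j ∈ Finset.range q, Real.exp (rotSum α W j x)) * M (tent q x) ≤
      7 * Real.exp (6 * (v 5 - v (-3))) := by
  set C := 6 * (v 5 - v (-3))
  have hsum : ∑ j ∈ Finset.range q, M (expMap (rotSum α W j) * tent q x) =
      M (∑ j ∈ Finset.range q, translateMap (-(j • (α : UnitAddCircle))) (tent q x)) := by
    rw [map_sum]
    exact Finset.sum_congr rfl fun j _ => (hM.map_translate_nsmul j _).symm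
  have hlow : 1 / 4 ≤ ∑ j ∈ Finset.range q, M (expMap (rotSum α W j) * tent q x) := by
    rw [hsum, ← hM.map_const (1 / 4)]
    refine hM.mono fun y => ?_
    simp only [ContinuousMap.const_apply, ContinuousMap.coe_sum, Finset.sum_apply,
      translateMap_tent]
    exact H.le_sum_tent _
  have hup : ∑ j ∈ Finset.range q, M (expMap (rotSum α W j) * tent q x) ≤ 7 := by
    rw [hsum, ← hM.map_const 7]
    refine hM.mono fun y => ?_
    simp only [ContinuousMap.const_apply, ContinuousMap.coe_sum, Finset.sum_apply,
      translateMap_tent]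
    exact H.sum_tent_le _
  have hsmul : ∀ (c : ℝ) (f : C(UnitAddCircle, ℝ)), c * M f = M (c • f) := fun c f => by
    rw [map_smul, smul_eq_mul]
  have hdist : ∀ j < q, ∀ y, tent q x y ≠ 0 → |rotSum α W j y - rotSum α W j x| ≤ C := by
    intro j hj y hy
    refine H.abs_rotSum_sub_le hv hj.le ?_
    by_contra! h
    exact hy (tent_eq_zero H.pos h.le)
  constructor
  · refine hlow.trans ?_
    rw [mul_assoc, Finset.sum_mul, Finset.mul_sum]
    refine Finset.sum_le_sum fun j hj => ?_
    rw [← mul_assoc, hsmul]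
    refine hM.mono fun y => ?_
    simp only [ContinuousMap.mul_apply, expMap_apply, ContinuousMap.smul_apply, smul_eq_mul]
    by_cases hy : tent q x y = 0
    · simp [hy]
    · have h := (abs_le.1 (hdist j (Finset.mem_range.1 hj) y hy)).2
      rw [← Real.exp_add]
      refine mul_le_mul_of_nonneg_right (Real.exp_le_exp.2 ?_) (tent_nonneg _ _ _)
      linarith
  · have : (∑ j ∈ Finset.range q, Real.exp (rotSum α W j x)) * M (tent q x) ≤
        Real.exp C * ∑ j ∈ Finset.range q, M (expMap (rotSum α W j) * tent q x) := by
      rw [Finset.sum_mul, Finset.mul_sum]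
      refine Finset.sum_le_sum fun j hj => ?_
      rw [hsmul, hsmul]
      refine hM.mono fun y => ?_
      simp only [ContinuousMap.mul_apply, expMap_apply, ContinuousMap.smul_apply, smul_eq_mul]
      by_cases hy : tent q x y = 0
      · simp [hy]
      · have h := (abs_le.1 (hdist j (Finset.mem_range.1 hj) y hy)).1
        rw [← mul_assoc, ← Real.exp_add]
        refine mul_le_mul_of_nonneg_right (Real.exp_le_exp.2 ?_) (tent_nonneg _ _ _)
        linarith
    refine this.trans ?_
    rw [mul_comm]
    gcongr

theorem tent_le (h₁ : IsConformal α W M₁) (h₂ : IsConformal α W M₂)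
    (H : IsDirichletApprox α p q) (hv : IsVariationBound W v) (x : UnitAddCircle) :
    M₁ (tent q x) ≤ 28 * Real.exp (6 * (v 5 - v (-3))) ^ 2 * M₂ (tent q x) := by
  obtain ⟨-, b⟩ := h₁.tent_bounds H hv x
  obtain ⟨c, -⟩ := h₂.tent_bounds H hv x
  set E := Real.exp (6 * (v 5 - v (-3)))
  set L := ∑ j ∈ Finset.range q, Real.exp (rotSum α W j x)
  have hE : 0 < E := Real.exp_pos _
  have hL : 0 < L := Finset.sum_pos (fun j _ => Real.exp_pos _)
    (Finset.nonempty_range_iff.2 H.pos.ne')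
  refine le_of_mul_le_mul_left ?_ hL
  calc L * M₁ (tent q x) ≤ 7 * E := b
    _ ≤ 28 * E * (E * L * M₂ (tent q x)) := by nlinarith
    _ = _ := by ring

/-- Two conformal functionals for a weight of bounded variation are comparable. -/
theorem le_const_mul (hα : Irrational α) (h₁ : IsConformal α W M₁) (h₂ : IsConformal α W M₂)
    (hv : IsVariationBound W v) {g : C(UnitAddCircle, ℝ)} (hg : ∀ y, 0 ≤ g y) :
    M₁ g ≤ 784 * Real.exp (6 * (v 5 - v (-3))) ^ 2 * M₂ g := by
  set E := Real.exp (6 * (v 5 - v (-3)))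
  have hE : 0 < E := Real.exp_pos _
  suffices h : ∀ ε : ℝ, 0 < ε → M₁ g ≤ 784 * E ^ 2 * (M₂ g + 2 * ε) by
    refine le_of_forall_pos_le_add fun δ hδ => ?_
    refine (h (δ / (1568 * E ^ 2)) (by positivity)).trans (le_of_eq ?_)
    field_simp
    ring
  intro ε hε
  obtain ⟨δ, hδ, hgδ⟩ := Metric.uniformContinuous_iff.1
    (CompactSpace.uniformContinuous_of_continuous g.continuous) ε hε
  obtain ⟨N, hN⟩ := exists_nat_gt (2 / δ)
  obtain ⟨p, q, H, hNq⟩ := exists_isDirichletApprox hα N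
  have hq := H.pos_real
  have hqδ : 2 / (q : ℝ) < δ := by
    rw [div_lt_comm₀ hq hδ]
    exact hN.trans_le (by exact_mod_cast hNq)
  have hclose : ∀ x y, tent q x y ≠ 0 → |g y - g x| < ε := by
    intro x y hy
    refine hgδ ?_
    rw [dist_eq_norm]
    by_contra! h
    exact hy (tent_eq_zero H.pos (hqδ.le.trans h))
  -- A combination of tents with g ≤ 4k and k ≤ 7(g + 2ε). The added ε absorbs the oscillation of g
  -- on each tent and keeps k above g/4. Then 784 = 4 · 28 · 7.
  let k : C(UnitAddCircle, ℝ) := ∑ j ∈ Finset.range q,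
    (g (j • (α : UnitAddCircle)) + ε) • tent q (j • (α : UnitAddCircle))
  have hk : ∀ y, k y = ∑ j ∈ Finset.range q,
      (g (j • (α : UnitAddCircle)) + ε) * tent q (j • (α : UnitAddCircle)) y := by
    intro y
    simp [k, ContinuousMap.coe_sum, Finset.sum_apply]
  have hlow : ∀ y, g y ≤ ((4 : ℝ) • k) y := by
    intro y
    have h₃ : g y * ∑ j ∈ Finset.range q, tent q (j • (α : UnitAddCircle)) y ≤ k y := by
      rw [hk, Finset.mul_sum]
      refine Finset.sum_le_sum fun j _ => ?_
      by_cases hy : tent q (j • (α : UnitAddCircle)) y = 0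
      · simp [hy]
      · have := (abs_lt.1 (hclose _ y hy)).2
        exact mul_le_mul_of_nonneg_right (by linarith) (tent_nonneg _ _ _)
    have h₄ := mul_le_mul_of_nonneg_left (H.le_sum_tent y) (hg y)
    rw [ContinuousMap.smul_apply, smul_eq_mul]
    linarith
  have hup : ∀ y, k y ≤ ((7 : ℝ) • (g + ContinuousMap.const UnitAddCircle (2 * ε)) : C(UnitAddCircle, ℝ)) y := by
    intro y
    have h₃ : k y ≤ (g y + 2 * ε) * ∑ j ∈ Finset.range q, tent q (j • (α : UnitAddCircle)) y := by
      rw [hk, Finset.mul_sum]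
      refine Finset.sum_le_sum fun j _ => ?_
      by_cases hy : tent q (j • (α : UnitAddCircle)) y = 0
      · simp [hy]
      · have := (abs_lt.1 (hclose _ y hy)).1
        exact mul_le_mul_of_nonneg_right (by linarith) (tent_nonneg _ _ _)
    have h₄ := mul_le_mul_of_nonneg_left (H.sum_tent_le y)
      (show 0 ≤ g y + 2 * ε by linarith [hg y])
    simp only [ContinuousMap.smul_apply, smul_eq_mul, ContinuousMap.add_apply,
      ContinuousMap.const_apply]
    linarith
  have hmid : M₁ k ≤ 28 * E ^ 2 * M₂ k := by
    simp only [k, map_sum, map_smul, smul_eq_mul, Finset.mul_sum]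
    refine Finset.sum_le_sum fun j _ => ?_
    have := mul_le_mul_of_nonneg_left (h₁.tent_le h₂ H hv (j • (α : UnitAddCircle)))
      (show 0 ≤ g (j • (α : UnitAddCircle)) + ε by linarith [hg (j • (α : UnitAddCircle))])
    linarith
  have hlow' := h₁.mono hlow
  have hup' := h₂.mono hup
  rw [map_smul, smul_eq_mul] at hlow'
  rw [map_smul, smul_eq_mul, map_add, h₂.map_const] at hup'
  calc M₁ g ≤ 4 * M₁ k := hlow'
    _ ≤ 4 * (28 * E ^ 2 * M₂ k) := by linarith
    _ ≤ 4 * (28 * E ^ 2 * (7 * (M₂ g + 2 * ε))) := by gcongr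
    _ = _ := by ring

/-- Over an irrational rotation, there is at most one conformal functional for a weight of bounded
variation. -/
theorem unique (hα : Irrational α) (h₁ : IsConformal α W M₁) (h₂ : IsConformal α W M₂)
    (hv : IsVariationBound W v) : M₁ = M₂ := by
  set K := 784 * Real.exp (6 * (v 5 - v (-3))) ^ 2
  have hK : 0 < K := by positivity
  let S : Set ℝ := {c | ∀ g, (∀ y, 0 ≤ g y) → c * M₂ g ≤ M₁ g}
  have hS1 : ∀ c ∈ S, c ≤ 1 := by
    intro c hc
    have := hc 1 fun y => zero_le_one
    rwa [h₁.map_one, h₂.map_one, mul_one] at this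
  have hS0 : (0 : ℝ) ∈ S := fun g hg => by rw [zero_mul]; exact h₁.nonneg g hg
  have hbdd : BddAbove S := ⟨1, hS1⟩
  set c := sSup S
  have hc1 : c ≤ 1 := csSup_le ⟨0, hS0⟩ hS1
  have hcS : c ∈ S := by
    intro g hg
    rcases (h₂.nonneg g hg).eq_or_lt with h | h
    · rw [← h, mul_zero]; exact h₁.nonneg g hg
    · rw [← le_div_iff₀ h]
      refine csSup_le ⟨0, hS0⟩ fun d hd => ?_
      rw [le_div_iff₀ h]
      exact hd g hg
  -- If c < 1, the normalised remainder M₁ - c M₂ is again conformal and so dominates M₂ up to the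
  -- factor K; then c could be enlarged by (1 - c)/K.
  have hc : c = 1 := by
    by_contra hne
    have hlt : 0 < 1 - c := sub_pos.2 (lt_of_le_of_ne hc1 hne)
    have h₃ : IsConformal α W ((1 - c)⁻¹ • (M₁ - c • M₂)) := by
      refine ⟨fun g hg => ?_, ?_, fun g => ?_⟩
      · have := hcS g hg
        simp only [LinearMap.smul_apply, LinearMap.sub_apply, smul_eq_mul]
        exact mul_nonneg (by positivity) (by linarith)
      · simp only [LinearMap.smul_apply, LinearMap.sub_apply, smul_eq_mul, h₁.map_one,
          h₂.map_one, mul_one]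
        exact inv_mul_cancel₀ hlt.ne'
      · simp only [LinearMap.smul_apply, LinearMap.sub_apply, smul_eq_mul, h₁.map_translate,
          h₂.map_translate]
    have h₄ : c + (1 - c) / K ∈ S := by
      intro g hg
      have h₅ := le_const_mul hα h₂ h₃ hv hg
      simp only [LinearMap.smul_apply, LinearMap.sub_apply, smul_eq_mul] at h₅
      change M₂ g ≤ K * ((1 - c)⁻¹ * (M₁ g - c * M₂ g)) at h₅
      have h₆ : (1 - c) / K * M₂ g ≤ M₁ g - c * M₂ g := by
        calc (1 - c) / K * M₂ g ≤ (1 - c) / K * (K * ((1 - c)⁻¹ * (M₁ g - c * M₂ g))) := by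
              gcongr
          _ = _ := by field_simp
      linarith
    have h₅ := le_csSup hbdd h₄
    have h₆ : 0 < (1 - c) / K := by positivity
    change c + (1 - c) / K ≤ c at h₅
    linarith
  -- Both functionals agree on constants, so adding ‖g‖ removes the sign condition, and g may then
  -- be replaced by -g.
  have hle : ∀ g : C(UnitAddCircle, ℝ), M₂ g ≤ M₁ g := by
    intro g
    have h := hcS (g + ContinuousMap.const _ ‖g‖) fun y => by
      have := (abs_le.1 (g.norm_coe_le_norm y)).1
      simp only [ContinuousMap.add_apply, ContinuousMap.const_apply]
      linarith
    rw [hc, one_mul, map_add, map_add, h₁.map_const, h₂.map_const] at h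
    linarith
  ext g
  refine le_antisymm ?_ (hle g)
  have := hle (-g)
  rw [map_neg, map_neg] at this
  linarith

end IsConformal

end Comparison

/-! ### Bounded variation under a homeomorphism -/

section Variation

theorem locallyBoundedVariationOn_univ_of_Icc {f : ℝ → ℝ} {δ : ℝ} (hδ : 0 < δ)
    (h : ∀ k : ℤ, BoundedVariationOn f (Set.Icc (k * δ) ((k + 1) * δ))) :
    LocallyBoundedVariationOn f Set.univ := by
  have hn : ∀ (k : ℤ) (n : ℕ), BoundedVariationOn f (Set.Icc (k * δ) ((k + n) * δ)) := by
    intro k n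
    induction n with
    | zero => simp [BoundedVariationOn]
    | succ n ih =>
      have := eVariationOn.Icc_add_Icc f (s := Set.univ) (a := k * δ) (b := (k + n) * δ)
        (c := (k + n + 1) * δ) (by gcongr; linarith [n.cast_nonneg (α := ℝ)])
        (by nlinarith) (Set.mem_univ _)
      simp only [Set.univ_inter] at this
      rw [BoundedVariationOn]
      push_cast
      rw [← add_assoc, ← this]
      have h' := h (k + n)
      push_cast at h'
      exact ENNReal.add_ne_top.2 ⟨ih, h'⟩
  intro a b _ _
  rw [Set.univ_inter]
  have ha := Int.floor_le (a / δ)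
  rw [le_div_iff₀ hδ] at ha
  obtain ⟨n, hn'⟩ := exists_nat_ge (b / δ - ⌊a / δ⌋)
  have hb : b ≤ (⌊a / δ⌋ + n) * δ := by
    rw [← div_le_iff₀ hδ]
    linarith
  exact (hn ⌊a / δ⌋ n).mono (Set.Icc_subset_Icc ha hb)

/-- A homeomorphism of the circle lifts to a continuous function on the line. -/
theorem exists_lift_circle (h : UnitAddCircle ≃ₜ UnitAddCircle) :
    ∃ H : ℝ → ℝ, Continuous H ∧ ∀ t : ℝ, (H t : UnitAddCircle) = h t := by
  obtain ⟨e₀, he₀⟩ := QuotientAddGroup.mk_surjective (h ((0 : ℝ) : UnitAddCircle))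
  obtain ⟨H, ⟨-, hH⟩, -⟩ := (AddCircle.isCoveringMap_coe (1 : ℝ)).existsUnique_continuousMap_lifts
    ⟨fun t : ℝ => h (t : UnitAddCircle), h.continuous.comp (AddCircle.continuous_mk' 1)⟩ 0 e₀ he₀
  exact ⟨H, H.continuous, fun t => congrFun hH t⟩

/-- A lift of h to the line is injective, hence monotone or antitone, on short intervals, and such a
change of variable does not increase variation. The orientation of h plays no role. -/
theorem locallyBoundedVariationOn_comp_homeomorph (h : UnitAddCircle ≃ₜ UnitAddCircle)
    {F : C(UnitAddCircle, ℝ)}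
    (hF : BoundedVariationOn (fun t : ℝ => F (t : UnitAddCircle)) (Set.Icc 0 1)) :
    LocallyBoundedVariationOn (fun t : ℝ => F (h (t : UnitAddCircle))) Set.univ := by
  have hFl : LocallyBoundedVariationOn (fun t : ℝ => F (t : UnitAddCircle)) Set.univ := by
    refine locallyBoundedVariationOn_univ_of_Icc one_pos fun k => ?_
    have e : (fun t : ℝ => F (t : UnitAddCircle)) =
        (fun t : ℝ => F (t : UnitAddCircle)) ∘ fun t : ℝ => t - k := by
      ext t
      simp only [Function.comp_apply]
      rw [AddCircle.coe_sub, coe_intCast_circle, sub_zero]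
    rw [e]
    refine ne_top_of_le_ne_top hF (eVariationOn.comp_le_of_monotoneOn _ _ ?_ ?_)
    · intro s _ t _ hst
      simpa using hst
    · intro t ht
      simp only [Set.mem_Icc, mul_one] at ht ⊢
      constructor <;> linarith [ht.1, ht.2]
  obtain ⟨H, hHc, hH⟩ := exists_lift_circle h
  have e : (fun t : ℝ => F (h (t : UnitAddCircle))) =
      (fun t : ℝ => F (t : UnitAddCircle)) ∘ H := by
    ext t
    simp [hH]
  rw [e]
  -- Any length below the period 1 makes the lift injective on the closed interval.
  refine locallyBoundedVariationOn_univ_of_Icc one_half_pos fun k => ?_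
  set a : ℝ := k * (1 / 2)
  set b : ℝ := (k + 1) * (1 / 2)
  have hab : b = a + 1 / 2 := by simp only [a, b]; ring
  have hle : a ≤ b := by linarith
  have hinj : Set.InjOn H (Set.Icc a b) := by
    intro s hs t ht hst
    have h₁ : (s : UnitAddCircle) = t := h.injective (by rw [← hH, ← hH, hst])
    have h₂ : ((s - t : ℝ) : UnitAddCircle) = 0 := by rw [AddCircle.coe_sub, h₁, sub_self]
    obtain ⟨n, hn⟩ := (AddCircle.coe_eq_zero_iff 1).1 h₂
    rw [zsmul_eq_mul, mul_one] at hn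
    have h₃ : |(n : ℝ)| < 1 := by
      rw [hn, abs_lt]
      constructor <;> linarith [hs.1, hs.2, ht.1, ht.2]
    have h₄ : n = 0 := Int.abs_lt_one_iff.1 (by exact_mod_cast h₃)
    rw [h₄, Int.cast_zero] at hn
    linarith
  rcases hHc.continuousOn.strictMonoOn_of_injOn_Icc' hle hinj with hm | hm
  · have hb := hFl (H a) (H b) trivial trivial
    rw [Set.univ_inter] at hb
    exact ne_top_of_le_ne_top hb (eVariationOn.comp_le_of_monotoneOn _ _ hm.monotoneOn
      fun t ht => ⟨hm.monotoneOn (Set.left_mem_Icc.2 hle) ht ht.1,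
        hm.monotoneOn ht (Set.right_mem_Icc.2 hle) ht.2⟩)
  · have hb := hFl (H b) (H a) trivial trivial
    rw [Set.univ_inter] at hb
    exact ne_top_of_le_ne_top hb (eVariationOn.comp_le_of_antitoneOn _ _ hm.antitoneOn
      fun t ht => ⟨hm.antitoneOn ht (Set.right_mem_Icc.2 hle) ht.2,
        hm.antitoneOn (Set.left_mem_Icc.2 hle) ht ht.1⟩)

/-- Jordan decomposition F∘h = p - q into monotone functions, with v = |β|(p + q). -/
theorem exists_isVariationBound (h : UnitAddCircle ≃ₜ UnitAddCircle) {F : C(UnitAddCircle, ℝ)}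
    (hF : BoundedVariationOn (fun t : ℝ => F (t : UnitAddCircle)) (Set.Icc 0 1)) (β : ℝ) :
    ∃ v, IsVariationBound (β • F.comp (h : C(UnitAddCircle, UnitAddCircle))) v := by
  obtain ⟨p, q, hp, hq, hpq⟩ :=
    (locallyBoundedVariationOn_comp_homeomorph h hF).exists_monotoneOn_sub_monotoneOn
  rw [monotoneOn_univ] at hp hq
  refine ⟨fun t => |β| * (p t + q t), fun s t hst => ?_, fun s t hst => ?_⟩
  · exact mul_le_mul_of_nonneg_left (add_le_add (hp hst) (hq hst)) (abs_nonneg β)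
  · have h₁ := congrFun hpq s
    have h₂ := congrFun hpq t
    simp only [Pi.sub_apply] at h₁ h₂
    have e : (β • F.comp (h : C(UnitAddCircle, UnitAddCircle))) (t : UnitAddCircle) -
        (β • F.comp (h : C(UnitAddCircle, UnitAddCircle))) (s : UnitAddCircle) =
        β * ((p t - p s) - (q t - q s)) := by
      change β * F (h t) - β * F (h s) = _
      rw [h₁, h₂]
      ring
    rw [e, abs_mul, ← mul_sub]
    refine mul_le_mul_of_nonneg_left ?_ (abs_nonneg β)
    rw [abs_le]
    constructor <;> linarith [hp hst, hq hst]

end Variation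

/-! ### Analytic generators and the KMS condition on them -/

section Flow

variable {X : Type u} [TopologicalSpace X]

/-- The function `x ↦ exp (-i z F x)` for complex `z`. -/
noncomputable def complexPhase (F : C(X, ℝ)) (z : ℂ) : C(X, ℂ) where
  toFun x := Complex.exp (-(Complex.I * z * F x))
  continuous_toFun := by fun_prop

theorem complexPhase_ofReal (F : C(X, ℝ)) (t : ℝ) : complexPhase F t = phase F t := rfl

theorem complexPhase_I_mul (F : C(X, ℝ)) (β : ℝ) (x : X) :
    complexPhase F (Complex.I * β) x = Complex.exp (β * F x) := by
  simp only [complexPhase, ContinuousMap.coe_mk]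
  congr 1
  linear_combination (-(β : ℂ) * F x) * Complex.I_sq

theorem complexPhase_mul_complexPhase_neg (F : C(X, ℝ)) (z : ℂ) :
    complexPhase F z * complexPhase F (-z) = 1 := by
  ext x
  simp [complexPhase, ← Complex.exp_add]

variable [CompactSpace X]

theorem differentiable_complexPhase (F : C(X, ℝ)) : Differentiable ℂ (complexPhase F) := by
  -- Norm differentiability in z comes from reading the phase as the Banach algebra exponential of
  -- zG.
  let G : C(X, ℂ) := ⟨fun x => -(Complex.I * F x), by fun_prop⟩
  have h : complexPhase F = fun z : ℂ => NormedSpace.exp (z • G) := by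
    ext z x
    have h₁ := NormedSpace.map_exp (ContinuousMap.evalStarAlgHom ℂ ℂ x)
      (continuous_eval_const x) (z • G)
    change _ = ContinuousMap.evalStarAlgHom ℂ ℂ x (NormedSpace.exp (z • G))
    rw [h₁, ← Complex.exp_eq_exp_ℂ]
    simp only [complexPhase, ContinuousMap.coe_mk]
    congr 1
    change _ = z * -(Complex.I * F x)
    ring
  rw [h]
  exact fun z => (hasDerivAt_exp_smul_const G z).differentiableAt

theorem starAlgHom_continuous {A B : Type*} [CStarAlgebra A] [CStarAlgebra B] (ψ : A →⋆ₐ[ℂ] B) :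
    Continuous ψ :=
  NonUnitalStarAlgHom.instContinuousLinearMapClassComplex.toContinuousMapClass.map_continuous ψ

/-- A `*`-homomorphism of C*-algebras as a continuous linear map. -/
noncomputable def starAlgHomCLM {A B : Type*} [CStarAlgebra A] [CStarAlgebra B]
    (ψ : A →⋆ₐ[ℂ] B) : A →L[ℂ] B :=
  ⟨ψ.toAlgHom.toLinearMap, starAlgHom_continuous ψ⟩

namespace CrossedProduct

variable {φ : X ≃ₜ X} {F : C(X, ℝ)}

theorem star_U_mul_U (φ : X ≃ₜ X) : star (U φ) * U φ = 1 :=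
  (Unitary.mem_iff.1 (U_mem_unitary φ)).1

theorem U_mul_star_U (φ : X ≃ₜ X) : U φ * star (U φ) = 1 :=
  (Unitary.mem_iff.1 (U_mem_unitary φ)).2

theorem crossedFlow_U (t : ℝ) :
    crossedFlow φ F t (U φ) = U φ * ofFunction φ (phase F t) := rfl

theorem isEntireExtension_ofFunction (f : C(X, ℂ)) :
    IsEntireExtension (crossedFlow φ F) (ofFunction φ f) fun _ => ofFunction φ f :=
  ⟨differentiable_const _, fun _ => rfl⟩

theorem isEntireExtension_U :
    IsEntireExtension (crossedFlow φ F) (U φ) fun z => U φ * ofFunction φ (complexPhase F z) :=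
  ⟨((starAlgHomCLM (ofFunction φ)).differentiable.comp (differentiable_complexPhase F)).const_mul _,
    fun _ => rfl⟩

theorem isEntireExtension_star_U :
    IsEntireExtension (crossedFlow φ F) (star (U φ))
      fun z => ofFunction φ (complexPhase F (-z)) * star (U φ) := by
  refine ⟨((starAlgHomCLM (ofFunction φ)).differentiable.comp
    ((differentiable_complexPhase F).comp differentiable_neg)).mul_const _, fun t => ?_⟩
  rw [map_star, crossedFlow_U, star_mul, ← map_star, star_phase, ← complexPhase_ofReal]
  push_cast
  rfl

theorem dense_adjoin (φ : X ≃ₜ X) :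
    Dense (StarAlgebra.adjoin ℂ (insert (U φ) (Set.range (ofFunction φ))) :
      Set (CrossedProduct φ)) := by
  have h := StarAlgHom.map_adjoin (productAdjoin φ).topologicalClosure.subtype
    (insert (U φ) (Set.range (ofFunction φ)))
  have h₁ : (productAdjoin φ).topologicalClosure.subtype ''
      (insert (U φ) (Set.range (ofFunction φ))) =
      insert (productUnitary φ) (Set.range (productFunction φ)) := by
    rw [Set.image_insert_eq, ← Set.range_comp]
    rfl
  rw [h₁] at h
  refine Subtype.dense_iff.2 ?_
  have h₂ : Subtype.val '' (StarAlgebra.adjoin ℂ (insert (U φ) (Set.range (ofFunction φ))) :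
      Set (CrossedProduct φ)) = (productAdjoin φ : Set (CovariantProduct φ)) :=
    congrArg (fun S : StarSubalgebra ℂ (CovariantProduct φ) => (S : Set (CovariantProduct φ))) h
  exact closure_mono h₂.ge

theorem crossedFlow_mem_adjoin (t : ℝ) {a : CrossedProduct φ}
    (ha : a ∈ StarAlgebra.adjoin ℂ (insert (U φ) (Set.range (ofFunction φ)))) :
    crossedFlow φ F t a ∈ StarAlgebra.adjoin ℂ (insert (U φ) (Set.range (ofFunction φ))) := by
  set S := StarAlgebra.adjoin ℂ (insert (U φ) (Set.range (ofFunction φ)))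
  have h : S ≤ S.comap (crossedFlow φ F t : CrossedProduct φ →⋆ₐ[ℂ] CrossedProduct φ) := by
    refine StarAlgebra.adjoin_le ?_
    rintro _ (rfl | ⟨f, rfl⟩)
    · change U φ * ofFunction φ (phase F t) ∈ S
      exact mul_mem (StarAlgebra.subset_adjoin ℂ _ (Set.mem_insert _ _))
        (StarAlgebra.subset_adjoin ℂ _ (Set.mem_insert_of_mem _ (Set.mem_range_self _)))
    · exact StarAlgebra.subset_adjoin ℂ _ (Set.mem_insert_of_mem _ ⟨_, rfl⟩)
  exact h ha

/-- The elements whose KMS identity holds against every b form an algebra, since ω(xyb) = ω(y b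
x(iβ)) = ω(b x(iβ) y(iβ)). So generators suffice, and the resulting conditions survive pointwise
limits. -/
theorem isKMSState_iff {β : ℝ} {ω : CrossedProduct φ →L[ℂ] ℂ} :
    IsKMSState (crossedFlow φ F) β ω ↔
      (∀ a, 0 ≤ ω (star a * a)) ∧ ω 1 = 1 ∧
      (∀ f b, ω (ofFunction φ f * b) = ω (b * ofFunction φ f)) ∧
      ∀ b, ω (U φ * b) = ω (b * (U φ * ofFunction φ (complexPhase F (Complex.I * β)))) := by
  constructor
  · intro h
    exact ⟨h.nonneg, h.map_one,
      fun f b => h.apply_mul_eq (crossedFlow_add φ F) (isEntireExtension_ofFunction f) b,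
      fun b => h.apply_mul_eq (crossedFlow_add φ F) isEntireExtension_U b⟩
  · rintro ⟨hn, h1, hf, hU⟩
    have hU' : ∀ b, ω (star (U φ) * b) =
        ω (b * (ofFunction φ (complexPhase F (-(Complex.I * β))) * star (U φ))) := by
      intro b
      set P := complexPhase F (Complex.I * β)
      set Q := complexPhase F (-(Complex.I * β))
      have hQP : ofFunction φ Q * ofFunction φ P = 1 := by
        rw [← map_mul, mul_comm, complexPhase_mul_complexPhase_neg, map_one]
      -- This substitution cancels U on one side and U P on the other (Q is the inverse of P),
      -- leaving the identity for U*.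
      have h := hU (star (U φ) * b * ofFunction φ Q * star (U φ))
      have e₁ : U φ * (star (U φ) * b * ofFunction φ Q * star (U φ)) =
          b * (ofFunction φ Q * star (U φ)) := by
        simp only [← mul_assoc, U_mul_star_U, one_mul]
      have e₂ : star (U φ) * b * ofFunction φ Q * star (U φ) * (U φ * ofFunction φ P) =
          star (U φ) * b := by
        rw [mul_assoc _ (star (U φ)), ← mul_assoc (star (U φ)) (U φ), star_U_mul_U, one_mul,
          mul_assoc _ _ (ofFunction φ P), hQP, mul_one]
      rw [e₁, e₂] at h
      exact h.symm
    refine ⟨hn, h1, (StarAlgebra.adjoin ℂ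
      (insert (U φ) (Set.range (ofFunction φ)))).toNonUnitalStarSubalgebra, dense_adjoin φ,
      fun t a ha => crossedFlow_mem_adjoin t ha, fun a ha => ?_⟩
    suffices H : ∃ f, IsEntireExtension (crossedFlow φ F) a f ∧
        ∀ b, ω (a * b) = ω (b * f (Complex.I * β)) by
      obtain ⟨f, h₁, h₂⟩ := H
      exact ⟨f, h₁, fun b _ => h₂ b⟩
    have ha' : a ∈ Algebra.adjoin ℂ (insert (U φ) (Set.range (ofFunction φ)) ∪
        star (insert (U φ) (Set.range (ofFunction φ)))) := by
      rw [← StarAlgebra.adjoin_toSubalgebra]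
      exact ha
    clear ha
    induction ha' using Algebra.adjoin_induction with
    | mem a ha =>
      rcases ha with (rfl | ⟨f, rfl⟩) | ha
      · exact ⟨_, isEntireExtension_U, hU⟩
      · exact ⟨_, isEntireExtension_ofFunction f, hf f⟩
      · rw [Set.mem_star] at ha
        rcases ha with ha | ⟨f, ha⟩
        · rw [eq_star_of_eq_star ha.symm]
          exact ⟨_, isEntireExtension_star_U, hU'⟩
        · rw [eq_star_of_eq_star ha, ← map_star]
          exact ⟨_, isEntireExtension_ofFunction _, hf _⟩
    | algebraMap r =>
      refine ⟨fun _ => algebraMap ℂ _ r, ⟨differentiable_const _, fun t => ?_⟩, fun b => ?_⟩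
      · exact (AlgHomClass.commutes (crossedFlow φ F t) r).symm
      · rw [Algebra.commutes]
    | add x y _ _ hx hy =>
      obtain ⟨f, ⟨hfd, hft⟩, hfω⟩ := hx
      obtain ⟨g, ⟨hgd, hgt⟩, hgω⟩ := hy
      refine ⟨fun z => f z + g z, ⟨hfd.add hgd, fun t => ?_⟩, fun b => ?_⟩
      · change f t + g t = _
        rw [hft, hgt, map_add]
      · rw [add_mul, map_add, hfω, hgω, mul_add, map_add]
    | mul x y _ _ hx hy =>
      obtain ⟨f, ⟨hfd, hft⟩, hfω⟩ := hx
      obtain ⟨g, ⟨hgd, hgt⟩, hgω⟩ := hy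
      refine ⟨fun z => f z * g z, ⟨hfd.mul hgd, fun t => ?_⟩, fun b => ?_⟩
      · change f t * g t = _
        rw [hft, hgt, map_mul]
      · rw [mul_assoc, hfω, mul_assoc, hgω, mul_assoc]

end CrossedProduct

end Flow

/-! ### Monomials f U^k span a dense subspace -/

section Monomials

variable {X : Type u} [TopologicalSpace X] [CompactSpace X]

namespace CrossedProduct

variable {φ : X ≃ₜ X}

/-- The powers `U ^ k`, `k ∈ ℤ`, of the canonical unitary. -/
noncomputable def UPow (φ : X ≃ₜ X) (k : ℤ) : CrossedProduct φ :=
  ((⟨U φ, U_mem_unitary φ⟩ : unitary (CrossedProduct φ)) ^ k : unitary (CrossedProduct φ))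

@[simp] theorem UPow_zero : UPow φ 0 = 1 := by simp [UPow]

theorem UPow_one : UPow φ 1 = U φ := by simp [UPow]

theorem UPow_neg_one : UPow φ (-1) = star (U φ) := by
  simp [UPow, ← Unitary.star_eq_inv]

theorem UPow_add (k l : ℤ) : UPow φ (k + l) = UPow φ k * UPow φ l := by
  simp [UPow, zpow_add]

theorem U_mul_ofFunction (f : C(X, ℂ)) :
    U φ * ofFunction φ f = ofFunction φ (f.comp (φ.symm : C(X, X))) * U φ := by
  rw [← U_covariant, mul_assoc, star_U_mul_U, mul_one]

theorem star_U_mul_ofFunction (f : C(X, ℂ)) :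
    star (U φ) * ofFunction φ f = ofFunction φ (f.comp (φ : C(X, X))) * star (U φ) := by
  have h := U_covariant φ (f.comp (φ : C(X, X)))
  have e : (f.comp (φ : C(X, X))).comp (φ.symm : C(X, X)) = f := by
    ext x; simp
  rw [e] at h
  rw [← h, mul_assoc, ← mul_assoc (star (U φ)), star_U_mul_U, one_mul]

theorem exists_UPow_mul_ofFunction (k : ℤ) (f : C(X, ℂ)) :
    ∃ f', UPow φ k * ofFunction φ f = ofFunction φ f' * UPow φ k := by
  induction k generalizing f with
  | zero => exact ⟨f, by simp⟩
  | succ k ih =>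
    obtain ⟨f', hf'⟩ := ih (f.comp (φ.symm : C(X, X)))
    refine ⟨f', ?_⟩
    rw [UPow_add, UPow_one, mul_assoc, U_mul_ofFunction, ← mul_assoc, hf', mul_assoc]
  | pred k ih =>
    obtain ⟨f', hf'⟩ := ih (f.comp (φ : C(X, X)))
    refine ⟨f', ?_⟩
    rw [sub_eq_add_neg, UPow_add, UPow_neg_one, mul_assoc, star_U_mul_ofFunction, ← mul_assoc, hf',
      mul_assoc]

theorem UPow_mul_eigenfunction {e : C(X, ℂ)} {c : ℂ} (hc : c ≠ 0)
    (he : e.comp (φ.symm : C(X, X)) = c • e) (k : ℤ) :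
    UPow φ k * ofFunction φ e = c ^ k • (ofFunction φ e * UPow φ k) := by
  have he' : e.comp (φ : C(X, X)) = c⁻¹ • e := by
    ext x
    have := congrArg (fun g : C(X, ℂ) => g (φ x)) he
    simp only [ContinuousMap.comp_apply, ContinuousMap.smul_apply, smul_eq_mul] at this ⊢
    have h' : e x = c * e (φ x) := by simpa using this
    rw [h', inv_mul_cancel_left₀ hc]
    rfl
  induction k with
  | zero => simp
  | succ k ih =>
    rw [UPow_add, UPow_one, mul_assoc, U_mul_ofFunction, he, map_smul, smul_mul_assoc,
      mul_smul_comm, ← mul_assoc, ih, smul_mul_assoc, smul_smul, zpow_add_one₀ hc, mul_comm c,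
      mul_assoc]
  | pred k ih =>
    rw [sub_eq_add_neg, UPow_add, UPow_neg_one, mul_assoc, star_U_mul_ofFunction, he', map_smul,
      smul_mul_assoc, mul_smul_comm, ← mul_assoc, ih, smul_mul_assoc, smul_smul,
      ← sub_eq_add_neg, zpow_sub_one₀ hc, mul_comm c⁻¹, mul_assoc]

theorem adjoin_le_span_monomials {a : CrossedProduct φ}
    (ha : a ∈ StarAlgebra.adjoin ℂ (insert (U φ) (Set.range (ofFunction φ)))) :
    a ∈ Submodule.span ℂ (Set.range fun p : C(X, ℂ) × ℤ => ofFunction φ p.1 * UPow φ p.2) := by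
  have hm : ∀ f k, ofFunction φ f * UPow φ k ∈
      Submodule.span ℂ (Set.range fun p : C(X, ℂ) × ℤ => ofFunction φ p.1 * UPow φ p.2) :=
    fun f k => Submodule.subset_span ⟨(f, k), rfl⟩
  have hf : ∀ f, ofFunction φ f ∈
      Submodule.span ℂ (Set.range fun p : C(X, ℂ) × ℤ => ofFunction φ p.1 * UPow φ p.2) :=
    fun f => by simpa using hm f 0
  have ha' : a ∈ Algebra.adjoin ℂ (insert (U φ) (Set.range (ofFunction φ)) ∪
      star (insert (U φ) (Set.range (ofFunction φ)))) := by
    rw [← StarAlgebra.adjoin_toSubalgebra]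
    exact ha
  clear ha
  induction ha' using Algebra.adjoin_induction with
  | mem a ha =>
    rcases ha with (rfl | ⟨f, rfl⟩) | ha
    · simpa [UPow_one] using hm 1 1
    · exact hf f
    · rw [Set.mem_star] at ha
      rcases ha with ha | ⟨f, ha⟩
      · rw [eq_star_of_eq_star ha.symm]
        simpa [UPow_neg_one] using hm 1 (-1)
      · rw [eq_star_of_eq_star ha, ← map_star]
        exact hf _
  | algebraMap r =>
    rw [← AlgHomClass.commutes (ofFunction φ) r]
    exact hf _
  | add x y _ _ hx hy => exact add_mem hx hy
  | mul x y hx₀ hy₀ hx hy =>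
    clear hx₀ hy₀
    induction hx using Submodule.span_induction with
    | mem x hx =>
      obtain ⟨⟨f, k⟩, rfl⟩ := hx
      induction hy using Submodule.span_induction with
      | mem y hy =>
        obtain ⟨⟨g, l⟩, rfl⟩ := hy
        obtain ⟨g', hg'⟩ := exists_UPow_mul_ofFunction (φ := φ) k g
        dsimp only
        rw [mul_assoc, ← mul_assoc (UPow φ k), hg', mul_assoc, ← UPow_add, ← mul_assoc, ← map_mul]
        exact hm _ _
      | zero => rw [mul_zero]; exact zero_mem _
      | add y z _ _ hy hz => rw [mul_add]; exact add_mem hy hz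
      | smul c y _ hy => rw [mul_smul_comm]; exact Submodule.smul_mem _ _ hy
    | zero => rw [zero_mul]; exact zero_mem _
    | add x z _ _ hx hz => rw [add_mul]; exact add_mem hx hz
    | smul c x _ hx => rw [smul_mul_assoc]; exact Submodule.smul_mem _ _ hx

theorem functional_ext {ω₁ ω₂ : CrossedProduct φ →L[ℂ] ℂ}
    (h : ∀ f k, ω₁ (ofFunction φ f * UPow φ k) = ω₂ (ofFunction φ f * UPow φ k)) : ω₁ = ω₂ := by
  refine ContinuousLinearMap.ext_on ((dense_adjoin φ).mono fun a ha =>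
    adjoin_le_span_monomials ha) ?_
  rintro _ ⟨⟨f, k⟩, rfl⟩
  exact h f k

end CrossedProduct

end Monomials

/-! ### From KMS states to conformal functionals -/

section Uniqueness

/-- A real-valued function viewed as a complex-valued one. -/
noncomputable def complexify {X : Type*} [TopologicalSpace X] (g : C(X, ℝ)) : C(X, ℂ) :=
  ⟨fun x => (g x : ℂ), by fun_prop⟩

@[simp] theorem complexify_apply {X : Type*} [TopologicalSpace X] (g : C(X, ℝ)) (x : X) :
    complexify g x = (g x : ℂ) := rfl

namespace IsKMSState

open CrossedProduct

variable {φ h : UnitAddCircle ≃ₜ UnitAddCircle} {α : ℝ} {F : C(UnitAddCircle, ℝ)} {β : ℝ}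
  {ω ω₁ ω₂ : CrossedProduct φ →L[ℂ] ℂ}

theorem nonneg_complexify (hω : IsKMSState (crossedFlow φ F) β ω) {g : C(UnitAddCircle, ℝ)}
    (hg : ∀ x, 0 ≤ g x) : 0 ≤ ω (ofFunction φ (complexify g)) := by
  let k : C(UnitAddCircle, ℂ) := complexify ⟨fun x => √(g x), by fun_prop⟩
  have : complexify g = star k * k := by
    ext x
    simp only [k, complexify_apply, ContinuousMap.mul_apply, ContinuousMap.star_apply,
      ContinuousMap.coe_mk, Complex.star_def, Complex.conj_ofReal]
    rw [← Complex.ofReal_mul, Real.mul_self_sqrt (hg x)]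
  rw [this, map_mul, map_star]
  exact hω.nonneg _

theorem im_complexify (hω : IsKMSState (crossedFlow φ F) β ω) (g : C(UnitAddCircle, ℝ)) :
    (ω (ofFunction φ (complexify g))).im = 0 := by
  have h₁ := hω.nonneg_complexify (g := g + ContinuousMap.const _ ‖g‖) fun x => by
    have := (abs_le.1 (g.norm_coe_le_norm x)).1
    simp only [ContinuousMap.add_apply, ContinuousMap.const_apply]
    linarith
  have e : complexify (g + ContinuousMap.const _ ‖g‖) = complexify g + (‖g‖ : ℂ) • 1 := by
    ext x; simp
  rw [e, map_add, map_add, map_smul, map_smul, show ofFunction φ 1 = 1 from _root_.map_one _,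
    hω.map_one] at h₁
  have := (Complex.le_def.1 h₁).2
  simpa using this.symm

/-- The functional induced on the functions in the coordinate in which `φ` is a rotation. -/
noncomputable def rotationFunctional (h : UnitAddCircle ≃ₜ UnitAddCircle)
    (ω : CrossedProduct φ →L[ℂ] ℂ) : C(UnitAddCircle, ℝ) →ₗ[ℝ] ℝ where
  toFun g := (ω (ofFunction φ (complexify (g.comp (h.symm : C(UnitAddCircle, UnitAddCircle)))))).re
  map_add' f g := by
    rw [← Complex.add_re, ← map_add, ← map_add]
    congr 3
    ext x
    simp
  map_smul' c g := by
    have : complexify ((c • g).comp (h.symm : C(UnitAddCircle, UnitAddCircle))) =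
        (c : ℂ) • complexify (g.comp (h.symm : C(UnitAddCircle, UnitAddCircle))) := by
      ext x; simp
    rw [this, map_smul, map_smul, smul_eq_mul, Complex.re_ofReal_mul]
    rfl

/-- Take b = f U* in the KMS identity for U: since U f U* = f ∘ φ⁻¹, it becomes ω(f ∘ φ⁻¹) = ω(f
exp(βF)), read in the coordinate given by h. -/
theorem isConformal (hφ : φ = (h.symm.trans (Homeomorph.addRight (α : UnitAddCircle))).trans h)
    (hω : IsKMSState (crossedFlow φ F) β ω) :
    IsConformal α (β • F.comp (h : C(UnitAddCircle, UnitAddCircle))) (rotationFunctional h ω) := by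
  obtain ⟨-, h1, -, hU⟩ := isKMSState_iff.1 hω
  refine ⟨fun g hg => ?_, ?_, fun g => ?_⟩
  · exact (Complex.le_def.1 (hω.nonneg_complexify
      (g := g.comp (h.symm : C(UnitAddCircle, UnitAddCircle))) fun x => hg _)).1
  · change (ω (ofFunction φ _)).re = 1
    have : complexify ((1 : C(UnitAddCircle, ℝ)).comp
        (h.symm : C(UnitAddCircle, UnitAddCircle))) = 1 := by ext x; simp
    rw [this, show ofFunction φ 1 = 1 from _root_.map_one _, h1, Complex.one_re]
  · change (ω (ofFunction φ _)).re = (ω (ofFunction φ _)).re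
    set f := complexify (g.comp (h.symm : C(UnitAddCircle, UnitAddCircle)))
    have e₁ : complexify ((translateMap (-α : UnitAddCircle) g).comp
        (h.symm : C(UnitAddCircle, UnitAddCircle))) =
        f.comp (φ.symm : C(UnitAddCircle, UnitAddCircle)) := by
      ext x
      have : φ.symm x = h (h.symm x + -α) := by
        rw [hφ]
        simp [Homeomorph.symm_trans_apply]
        rfl
      simp only [f, complexify_apply, ContinuousMap.comp_apply]
      rw [show (φ.symm : C(UnitAddCircle, UnitAddCircle)) x = φ.symm x from rfl, this]
      simp
    have e₂ : complexify ((expMap (β • F.comp (h : C(UnitAddCircle, UnitAddCircle))) * g).comp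
        (h.symm : C(UnitAddCircle, UnitAddCircle))) = f * complexPhase F (Complex.I * β) := by
      ext x
      rw [ContinuousMap.mul_apply, complexPhase_I_mul]
      simp [f, mul_comm]
    have h₁ := hU (ofFunction φ f * star (U φ))
    rw [← mul_assoc, U_covariant, mul_assoc, ← mul_assoc (star (U φ)), star_U_mul_U, one_mul,
      ← map_mul] at h₁
    rw [e₁, e₂, h₁]

theorem ofFunction_eq_of_rotationFunctional_eq
    (h₁ : IsKMSState (crossedFlow φ F) β ω₁) (h₂ : IsKMSState (crossedFlow φ F) β ω₂)
    (heq : rotationFunctional h ω₁ = rotationFunctional h ω₂) (f : C(UnitAddCircle, ℂ)) :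
    ω₁ (ofFunction φ f) = ω₂ (ofFunction φ f) := by
  have hr : ∀ g : C(UnitAddCircle, ℝ),
      ω₁ (ofFunction φ (complexify g)) = ω₂ (ofFunction φ (complexify g)) := by
    intro g
    refine Complex.ext ?_ (by rw [h₁.im_complexify, h₂.im_complexify])
    have := LinearMap.congr_fun heq (g.comp (h : C(UnitAddCircle, UnitAddCircle)))
    have e : (g.comp (h : C(UnitAddCircle, UnitAddCircle))).comp
        (h.symm : C(UnitAddCircle, UnitAddCircle)) = g := by ext x; simp
    simpa only [rotationFunctional, LinearMap.coe_mk, AddHom.coe_mk, e] using this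
  have e : f = complexify ⟨fun x => (f x).re, by fun_prop⟩ +
      Complex.I • complexify ⟨fun x => (f x).im, by fun_prop⟩ := by
    ext x
    simp [mul_comm Complex.I, Complex.re_add_im]
  rw [e]
  simp only [map_add, map_smul, hr]

/-- The function e = exp(2πi h⁻¹) is a unitary eigenfunction of `φ`. As ω commutes with functions,
moving e around gives ω(f U^k) = ω(e* f U^k e) = c^k ω(f U^k), and c^k ≠ 1 because α is irrational.
-/
theorem monomial_eq_zero (hα : Irrational α)
    (hφ : φ = (h.symm.trans (Homeomorph.addRight (α : UnitAddCircle))).trans h)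
    (hω : IsKMSState (crossedFlow φ F) β ω) (f : C(UnitAddCircle, ℂ)) {k : ℤ} (hk : k ≠ 0) :
    ω (ofFunction φ f * UPow φ k) = 0 := by
  obtain ⟨-, -, hf, -⟩ := isKMSState_iff.1 hω
  let e : C(UnitAddCircle, ℂ) := (fourier 1).comp (h.symm : C(UnitAddCircle, UnitAddCircle))
  set c : ℂ := fourier (-1) (α : UnitAddCircle) with hc
  have hcn : ‖c‖ = 1 := norm_fourier_apply _ _
  have hc0 : c ≠ 0 := by
    intro h0
    rw [h0, norm_zero] at hcn
    exact zero_ne_one hcn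
  have hck : c ^ k ≠ 1 := by
    have : c ^ k = fourier (-k) (α : UnitAddCircle) := by
      rw [hc, fourier_apply, fourier_apply, ← Circle.coe_zpow, ← AddCircle.toCircle_zsmul,
        smul_smul, mul_neg_one]
    rw [this]
    exact fourier_irrational_ne_one hα (neg_ne_zero.2 hk)
  have he : e.comp (φ.symm : C(UnitAddCircle, UnitAddCircle)) = c • e := by
    ext x
    have : h.symm (φ.symm x) = h.symm x + -α := by
      rw [hφ]
      simp [Homeomorph.symm_trans_apply]
      rfl
    change (fourier 1 (h.symm (φ.symm x)) : ℂ) = c * fourier 1 (h.symm x)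
    rw [this, fourier_add_right, mul_comm, hc]
    congr 1
    simp only [fourier_apply, smul_neg, neg_smul]
  have hee : e * star e = 1 := by
    ext x
    change (fourier 1 (h.symm x) : ℂ) * starRingEnd ℂ (fourier 1 (h.symm x)) = 1
    rw [Complex.mul_conj, Complex.normSq_eq_norm_sq, norm_fourier_apply]
    simp
  have h₁ := hf e (ofFunction φ (star e * f) * UPow φ k)
  rw [mul_assoc _ (UPow φ k), UPow_mul_eigenfunction hc0 he, mul_smul_comm, map_smul, ← mul_assoc,
    ← mul_assoc, ← map_mul, ← map_mul, mul_comm (star e * f), ← mul_assoc, hee, one_mul,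
    smul_eq_mul] at h₁
  have h₂ : (1 - c ^ k) * ω (ofFunction φ f * UPow φ k) = 0 := by
    linear_combination h₁
  exact (mul_eq_zero.1 h₂).resolve_left (sub_ne_zero.2 hck.symm)

/-- There is at most one `β`-KMS state when `F` has bounded variation. -/
theorem unique (hα : Irrational α)
    (hφ : φ = (h.symm.trans (Homeomorph.addRight (α : UnitAddCircle))).trans h)
    (hF : BoundedVariationOn (fun t : ℝ => F (t : UnitAddCircle)) (Set.Icc 0 1))
    (h₁ : IsKMSState (crossedFlow φ F) β ω₁) (h₂ : IsKMSState (crossedFlow φ F) β ω₂) :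
    ω₁ = ω₂ := by
  obtain ⟨v, hv⟩ := exists_isVariationBound h hF β
  have heq := (h₁.isConformal hφ).unique hα (h₂.isConformal hφ) hv
  refine functional_ext fun f k => ?_
  by_cases hk : k = 0
  · simp only [hk, UPow_zero, mul_one]
    exact h₁.ofFunction_eq_of_rotationFunctional_eq h₂ heq f
  · rw [h₁.monomial_eq_zero hα hφ f hk, h₂.monomial_eq_zero hα hφ f hk]

theorem integral_eq_zero (hα : Irrational α)
    (hφ : φ = (h.symm.trans (Homeomorph.addRight (α : UnitAddCircle))).trans h)
    (hω : IsKMSState (crossedFlow φ F) β ω) (hβ : β ≠ 0) :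
    ∫ x : UnitAddCircle, F (h x) = 0 := by
  have h₁ := (hω.isConformal hφ).integral_eq_zero hα
  change ∫ x : UnitAddCircle, β * F (h x) = 0 at h₁
  rw [integral_const_mul] at h₁
  exact (mul_eq_zero.1 h₁).resolve_left hβ

end IsKMSState

end Uniqueness

/-! ### Approximately conformal weights along an orbit -/

section Weights

/-- The two-sided Birkhoff sum `S` with `S 0 = 0` and `S (n + 1) - S n = c n`. -/
noncomputable def intSum (c : ℤ → ℝ) (n : ℤ) : ℝ :=
  ∑ i ∈ Finset.range n.toNat, c i - ∑ i ∈ Finset.range (-n).toNat, c (-(i + 1))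

theorem intSum_natCast (c : ℤ → ℝ) (m : ℕ) : intSum c m = ∑ i ∈ Finset.range m, c i := by
  have : (-(m : ℤ)).toNat = 0 := by omega
  simp [intSum, this]

theorem intSum_neg_natCast (c : ℤ → ℝ) (m : ℕ) :
    intSum c (-m) = -∑ i ∈ Finset.range m, c (-(i + 1)) := by
  have : (-(m : ℤ)).toNat = 0 := by omega
  simp [intSum, this]

theorem intSum_add_one (c : ℤ → ℝ) (n : ℤ) : intSum c (n + 1) = intSum c n + c n := by
  obtain ⟨m, rfl | rfl⟩ : ∃ m : ℕ, n = m ∨ n = -(m + 1 : ℕ) := by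
    rcases le_or_gt 0 n with h | h
    · exact ⟨n.toNat, Or.inl (by omega)⟩
    · exact ⟨(-n - 1).toNat, Or.inr (by omega)⟩
  · rw [intSum_natCast, ← Nat.cast_succ, intSum_natCast, Finset.sum_range_succ]
  · have : -((m + 1 : ℕ) : ℤ) + 1 = -(m : ℤ) := by push_cast; ring
    rw [this, intSum_neg_natCast, intSum_neg_natCast, Finset.sum_range_succ]
    push_cast
    ring

theorem exists_bound_of_eventually_le {u : ℕ → ℝ} {δ : ℝ} (hδ : 0 ≤ δ)
    (h : ∀ᶠ n : ℕ in atTop, |u n| ≤ δ * n) : ∃ C, ∀ n : ℕ, |u n| ≤ C + δ * n := by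
  obtain ⟨N, hN⟩ := eventually_atTop.1 h
  refine ⟨∑ i ∈ Finset.range N, |u i|, fun n => ?_⟩
  have h0 : 0 ≤ ∑ i ∈ Finset.range N, |u i| := Finset.sum_nonneg fun i _ => abs_nonneg _
  have h1 : 0 ≤ δ * n := by positivity
  rcases le_or_gt N n with hn | hn
  · linarith [hN n hn]
  · have := Finset.single_le_sum (f := fun i => |u i|) (fun i _ => abs_nonneg _)
      (Finset.mem_range.2 hn)
    linarith

variable {α : ℝ} {W : C(UnitAddCircle, ℝ)}

/-- With zero mean, equidistribution makes the sums sublinear. Negative n use the rotation by -α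
started at y - α, because the backward sum begins at index -1. -/
theorem exists_bound_intSum (hα : Irrational α) (hW : ∫ x, W x = 0) (y : UnitAddCircle) {δ : ℝ}
    (hδ : 0 < δ) :
    ∃ C, ∀ n : ℤ, |intSum (fun k => W (y + k • (α : UnitAddCircle))) n| ≤ C + δ * |(n : ℝ)| := by
  obtain ⟨C₁, h₁⟩ := exists_bound_of_eventually_le hδ.le
    (u := fun m => intSum (fun k => W (y + k • (α : UnitAddCircle))) m) (by
      filter_upwards [eventually_abs_sum_sub_integral_le hα W hδ] with m hm
      rw [intSum_natCast]
      simpa [hW] using hm y)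
  obtain ⟨C₂, h₂⟩ := exists_bound_of_eventually_le hδ.le
    (u := fun m => intSum (fun k => W (y + k • (α : UnitAddCircle))) (-m)) (by
      filter_upwards [eventually_abs_sum_sub_integral_le hα.neg W hδ] with m hm
      rw [intSum_neg_natCast, abs_neg]
      have h := hm (y - α)
      rw [hW, mul_zero, sub_zero] at h
      refine le_of_eq_of_le (congrArg abs (Finset.sum_congr rfl fun i _ => congrArg W ?_)) h
      rw [AddCircle.coe_neg, neg_smul, add_smul, natCast_zsmul, one_smul, smul_neg]
      abel)
  refine ⟨max C₁ C₂, fun n => ?_⟩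
  obtain ⟨m, rfl | rfl⟩ := n.eq_nat_or_neg
  · refine (h₁ m).trans ?_
    push_cast
    rw [Nat.abs_cast]
    gcongr
    exact le_max_left _ _
  · refine (h₂ m).trans ?_
    push_cast
    rw [abs_neg, Nat.abs_cast]
    gcongr
    exact le_max_right _ _

theorem summable_exp_neg_mul_abs_int {s : ℝ} (hs : 0 < s) :
    Summable fun n : ℤ => Real.exp (-s * |(n : ℝ)|) := by
  have h : Summable fun n : ℕ => Real.exp (-s * n) := by
    have := Real.summable_exp_nat_mul_iff.2 (neg_neg_of_pos hs)
    simpa [mul_comm] using this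
  refine Summable.of_nat_of_neg ?_ ?_ <;> simpa using h

/-- Approximately conformal probability weights along an orbit of an irrational rotation. -/
theorem exists_approx_conformal_weights (hα : Irrational α) (hW : ∫ x, W x = 0)
    (y : UnitAddCircle) {ε : ℝ} (hε : 0 < ε) :
    ∃ p : ℤ → ℝ, (∀ n, 0 ≤ p n) ∧ HasSum p 1 ∧
      ∀ n, |p (n + 1) - p n * Real.exp (W (y + n • (α : UnitAddCircle)))| ≤ ε * p (n + 1) := by
  set c : ℤ → ℝ := fun k => W (y + k • (α : UnitAddCircle)) with hc
  have hs : 0 < Real.log (1 + ε) := Real.log_pos (by linarith)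
  set s := Real.log (1 + ε) with hsdef
  have hexp : Real.exp s = 1 + ε := Real.exp_log (by linarith)
  obtain ⟨C, hC⟩ := exists_bound_intSum hα hW y (half_pos hs)
  -- Without damping these would be exactly conformal but possibly not summable. The sum grows at
  -- rate at most s/2, so damping at rate s gives summability and costs a factor between exp(-s) and
  -- exp(s) = 1 + ε per step.
  let r : ℤ → ℝ := fun n => Real.exp (intSum c n - s * |(n : ℝ)|)
  have hr0 : ∀ n, 0 < r n := fun n => Real.exp_pos _
  have hsum : Summable r := by
    refine Summable.of_nonneg_of_le (fun n => (hr0 n).le) (fun n => ?_)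
      ((summable_exp_neg_mul_abs_int (half_pos hs)).mul_left (Real.exp C))
    rw [← Real.exp_add]
    refine Real.exp_le_exp.2 ?_
    have := (abs_le.1 (hC n)).2
    linarith
  have hpos : 0 < ∑' n, r n := hsum.tsum_pos (fun n => (hr0 n).le) 0 (hr0 0)
  refine ⟨fun n => r n / ∑' n, r n, fun n => div_nonneg (hr0 n).le hpos.le, ?_, fun n => ?_⟩
  · have := hsum.hasSum.div_const (∑' n, r n)
    rwa [div_self hpos.ne'] at this
  · have hn : r n * Real.exp (c n) = r (n + 1) * Real.exp (s * (|((n + 1 : ℤ) : ℝ)| - |(n : ℝ)|)) := by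
      simp only [r, ← Real.exp_add]
      rw [intSum_add_one]
      congr 1
      ring
    have habs : |(|((n + 1 : ℤ) : ℝ)| - |(n : ℝ)|)| ≤ 1 := by
      refine (abs_abs_sub_abs_le _ _).trans ?_
      push_cast
      simp
    set d := |((n + 1 : ℤ) : ℝ)| - |(n : ℝ)|
    obtain ⟨hd₁, hd₂⟩ := abs_le.1 habs
    have hdiff : r (n + 1) / (∑' n, r n) - r n / (∑' n, r n) * Real.exp (c n) =
        r (n + 1) / (∑' n, r n) * (1 - Real.exp (s * d)) := by
      rw [div_mul_eq_mul_div, hn]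
      ring
    dsimp only
    change |r (n + 1) / (∑' n, r n) - r n / (∑' n, r n) * Real.exp (c n)| ≤ _
    have hq : 0 ≤ r (n + 1) / ∑' n, r n := div_nonneg (hr0 _).le hpos.le
    rw [hdiff, abs_mul, abs_of_nonneg hq, mul_comm]
    refine mul_le_mul_of_nonneg_right ?_ hq
    have h₁ : Real.exp (s * d) ≤ 1 + ε := by
      rw [← hexp]
      exact Real.exp_le_exp.2 (by nlinarith)
    have h₂ : 1 - ε ≤ Real.exp (s * d) := by
      have : Real.exp (-s) ≤ Real.exp (s * d) := Real.exp_le_exp.2 (by nlinarith)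
      refine le_trans ?_ this
      rw [Real.exp_neg, hexp, ← one_div, le_div_iff₀ (by linarith)]
      nlinarith
    rw [abs_le]
    constructor <;> linarith

end Weights

/-! ### The orbit representation on ℓ²(ℤ) -/

section Orbit

/-- The Hilbert space `ℓ²(ℤ)`. -/
abbrev IntHilbert : Type := lp (fun _ : ℤ => ℂ) 2

/-- The operator `(T ξ) n = w n * ξ (σ n)`. -/
noncomputable def weightedComp (σ : Equiv.Perm ℤ) (w : ℤ → ℂ) (C : ℝ) (hw : ∀ n, ‖w n‖ ≤ C) :
    IntHilbert →L[ℂ] IntHilbert :=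
  have hC : 0 ≤ C := (norm_nonneg _).trans (hw 0)
  have hr : 0 < (2 : ℝ≥0∞).toReal := by norm_num
  have hle : ∀ (ξ : IntHilbert) n, ‖w n * ξ (σ n)‖ ^ (2 : ℝ≥0∞).toReal ≤
      C ^ (2 : ℝ≥0∞).toReal * ‖ξ (σ n)‖ ^ (2 : ℝ≥0∞).toReal := fun ξ n => by
    rw [norm_mul, Real.mul_rpow (norm_nonneg _) (norm_nonneg _)]
    gcongr
    exact hw n
  have hsum : ∀ ξ : IntHilbert, Summable fun n =>
      C ^ (2 : ℝ≥0∞).toReal * ‖ξ (σ n)‖ ^ (2 : ℝ≥0∞).toReal := fun ξ =>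
    ((σ.summable_iff (f := fun n => ‖ξ n‖ ^ (2 : ℝ≥0∞).toReal)).2
      ((lp.memℓp ξ).summable hr)).mul_left _
  have hsum' : ∀ ξ : IntHilbert, Summable fun n => ‖w n * ξ (σ n)‖ ^ (2 : ℝ≥0∞).toReal := fun ξ =>
    Summable.of_nonneg_of_le (fun n => by positivity) (hle ξ) (hsum ξ)
  LinearMap.mkContinuous
    { toFun := fun ξ => ⟨fun n => w n * ξ (σ n), memℓp_gen (hsum' ξ)⟩
      map_add' := fun ξ η => by
        ext n
        exact mul_add _ _ _
      map_smul' := fun c ξ => by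
        ext n
        exact mul_left_comm _ _ _ } C fun ξ => by
    refine lp.norm_le_of_tsum_le hr (by positivity) ?_
    rw [Real.mul_rpow hC (norm_nonneg _), lp.norm_rpow_eq_tsum hr,
      ← σ.tsum_eq fun n => ‖ξ n‖ ^ (2 : ℝ≥0∞).toReal, ← tsum_mul_left]
    exact (hsum' ξ).tsum_le_tsum (hle ξ) (hsum ξ)

@[simp] theorem weightedComp_apply (σ : Equiv.Perm ℤ) (w : ℤ → ℂ) (C : ℝ) (hw : ∀ n, ‖w n‖ ≤ C)
    (ξ : IntHilbert) (n : ℤ) : weightedComp σ w C hw ξ n = w n * ξ (σ n) := rfl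

/-- Closure of the family under adjoints lets multiplications and the shift be treated alike in
`orbitRep`. -/
theorem star_weightedComp (σ : Equiv.Perm ℤ) (w : ℤ → ℂ) (C : ℝ) (hw : ∀ n, ‖w n‖ ≤ C) :
    star (weightedComp σ w C hw) =
      weightedComp σ.symm (fun n => star (w (σ.symm n))) C (fun n => by simpa using hw _) := by
  rw [ContinuousLinearMap.star_eq_adjoint, eq_comm, ContinuousLinearMap.eq_adjoint_iff]
  intro ξ η
  rw [lp.inner_eq_tsum, lp.inner_eq_tsum, ← σ.tsum_eq]
  refine tsum_congr fun n => ?_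
  simp only [weightedComp_apply, Equiv.symm_apply_apply, RCLike.inner_apply]
  simp only [map_mul, Complex.star_def, Complex.conj_conj]
  ring

theorem IntHilbert.op_ext {S T : IntHilbert →L[ℂ] IntHilbert} (h : ∀ ξ n, S ξ n = T ξ n) :
    S = T :=
  ContinuousLinearMap.ext fun ξ => lp.ext (funext (h ξ))

instance : Nontrivial IntHilbert :=
  ⟨⟨lp.single 2 0 1, 0, fun h => by
    have := congrArg (fun ξ : IntHilbert => ξ 0) h
    simp at this⟩⟩

variable {X : Type} [TopologicalSpace X] [CompactSpace X] {φ : X ≃ₜ X}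

/-- The covariant representation on `ℓ²(ℤ)` given by an orbit of `φ`. -/
noncomputable def orbitRep (x : ℤ → X) (hx : ∀ n, φ (x n) = x (n + 1)) : CovariantRep φ where
  B := IntHilbert →L[ℂ] IntHilbert
  π :=
    { toFun := fun f => weightedComp 1 (fun n => f (x n)) ‖f‖ fun n => f.norm_coe_le_norm _
      map_one' := IntHilbert.op_ext fun ξ n => by simp
      map_mul' := fun f g => IntHilbert.op_ext fun ξ n => by simp [mul_assoc]
      map_zero' := IntHilbert.op_ext fun ξ n => by simp
      map_add' := fun f g => IntHilbert.op_ext fun ξ n => by simp [add_mul]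
      commutes' := fun c => IntHilbert.op_ext fun ξ n => by simp [Algebra.algebraMap_eq_smul_one]
      map_star' := fun f => by
        rw [star_weightedComp]
        exact IntHilbert.op_ext fun ξ n => by simp; rfl }
  u := weightedComp (Equiv.addRight (-1)) (fun _ => 1) 1 fun _ => by simp
  mem_unitary := by
    rw [Unitary.mem_iff, star_weightedComp]
    constructor <;> exact IntHilbert.op_ext fun ξ n => by simp
  covariant f := by
    rw [star_weightedComp]
    refine IntHilbert.op_ext fun ξ n => ?_
    have h : φ.symm (x n) = x (n + -1) := by
      rw [Homeomorph.symm_apply_eq, hx, neg_add_cancel_right]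
    simp [h]

end Orbit

/-! ### Mixtures of the basis vector states -/

section DiagonalState

variable {A : Type*} [CStarAlgebra A] (ψ : A →⋆ₐ[ℂ] (IntHilbert →L[ℂ] IntHilbert))

/-- The standard orthonormal basis of `ℓ²(ℤ)`. -/
noncomputable def basisVec (n : ℤ) : IntHilbert := lp.single 2 n 1

theorem basisVec_self (n : ℤ) : basisVec n n = 1 :=
  lp.single_apply_self (E := fun _ : ℤ => ℂ) 2 n 1

theorem basisVec_ne {m n : ℤ} (h : m ≠ n) : basisVec n m = 0 :=
  lp.single_apply_ne (E := fun _ : ℤ => ℂ) 2 n 1 h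

theorem norm_basisVec (n : ℤ) : ‖basisVec n‖ = 1 := by
  rw [basisVec, lp.norm_single (by norm_num)]
  simp

theorem norm_coeff_le (a : A) (i j : ℤ) : ‖ψ a (basisVec j) i‖ ≤ ‖a‖ :=
  calc ‖ψ a (basisVec j) i‖ ≤ ‖ψ a (basisVec j)‖ := lp.norm_apply_le_norm (by norm_num) _ _
    _ ≤ ‖ψ a‖ * ‖basisVec j‖ := (ψ a).le_opNorm _
    _ ≤ ‖a‖ := by
      rw [norm_basisVec, mul_one]
      exact NonUnitalStarAlgHom.norm_apply_le ψ a

theorem coeff_star_mul_self (a : A) (n : ℤ) :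
    ψ (star a * a) (basisVec n) n = ((‖ψ a (basisVec n)‖ ^ 2 : ℝ) : ℂ) := by
  have h₁ : ψ (star a * a) (basisVec n) n =
      ⟪basisVec n, ψ (star a * a) (basisVec n)⟫_ℂ := by
    rw [basisVec, lp.inner_single_left]
    simp
  rw [h₁, map_mul, map_star, ContinuousLinearMap.star_eq_adjoint]
  change ⟪basisVec n, ContinuousLinearMap.adjoint (ψ a) (ψ a (basisVec n))⟫_ℂ = _
  rw [ContinuousLinearMap.adjoint_inner_right, inner_self_eq_norm_sq_to_K]
  norm_cast

variable {p : ℤ → ℝ}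

theorem summable_weighted_coeff (hp : ∀ n, 0 ≤ p n) (hsum : HasSum p 1) (a : A) (i : ℤ → ℤ) :
    Summable fun n => (p n : ℂ) * ψ a (basisVec n) (i n) := by
  refine Summable.of_norm_bounded (hsum.summable.mul_right ‖a‖) fun n => ?_
  rw [norm_mul, Complex.norm_real, Real.norm_of_nonneg (hp n)]
  exact mul_le_mul_of_nonneg_left (norm_coeff_le ψ a _ _) (hp n)

/-- The convex combination with weights `p` of the vector states given by the basis of `ℓ²(ℤ)`. -/
theorem exists_diagonal_functional (hp : ∀ n, 0 ≤ p n) (hsum : HasSum p 1) :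
    ∃ ω : A →L[ℂ] ℂ, ‖ω‖ ≤ 1 ∧
      ∀ a, HasSum (fun n => (p n : ℂ) * ψ a (basisVec n) n) (ω a) := by
  have hs := fun a => summable_weighted_coeff ψ hp hsum a fun n => n
  let L : A →ₗ[ℂ] ℂ :=
    { toFun := fun a => ∑' n, (p n : ℂ) * ψ a (basisVec n) n
      map_add' := fun a b => by
        rw [← (hs a).tsum_add (hs b)]
        refine tsum_congr fun n => ?_
        rw [map_add, ← mul_add]
        rfl
      map_smul' := fun c a => by
        rw [RingHom.id_apply, smul_eq_mul, ← tsum_mul_left]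
        refine tsum_congr fun n => ?_
        rw [map_smul, mul_left_comm]
        rfl }
  have hL : ∀ a, ‖L a‖ ≤ 1 * ‖a‖ := fun a => by
    refine tsum_of_norm_bounded (hsum.mul_right ‖a‖) fun n => ?_
    rw [norm_mul, Complex.norm_real, Real.norm_of_nonneg (hp n)]
    exact mul_le_mul_of_nonneg_left (norm_coeff_le ψ a _ _) (hp n)
  exact ⟨L.mkContinuous 1 hL, L.mkContinuous_norm_le zero_le_one hL, fun a => (hs a).hasSum⟩

end DiagonalState

/-! ### Approximate KMS states and their limits -/

section Existence

open CrossedProduct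

variable {X : Type} [TopologicalSpace X] [CompactSpace X] {φ : X ≃ₜ X}

theorem exists_orbit_hom (x : ℤ → X) (hx : ∀ n, φ (x n) = x (n + 1)) :
    ∃ ψ : CrossedProduct φ →⋆ₐ[ℂ] (IntHilbert →L[ℂ] IntHilbert),
      (∀ f ξ n, ψ (ofFunction φ f) ξ n = f (x n) * ξ n) ∧
      ∀ ξ n, ψ (U φ) ξ n = ξ (n + -1) := by
  obtain ⟨ψ, ⟨h₁, h₂⟩, -⟩ := existsUnique_lift (orbitRep x hx)
  refine ⟨ψ, fun f ξ n => ?_, fun ξ n => ?_⟩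
  · exact congrArg (fun T : IntHilbert →L[ℂ] IntHilbert => T ξ n) (h₁ f)
  · exact (congrArg (fun T : IntHilbert →L[ℂ] IntHilbert => T ξ n) h₂).trans (one_mul _)

/-- Functions act diagonally, so they commute exactly under the mixture ω. For U, both sides of the
identity are sums of the same matrix coefficients of b, with weights p(n + 1) and p(n) exp(βF(x n)).
-/
theorem exists_approx_KMS (F : C(X, ℝ)) (β : ℝ) (x : ℤ → X) (hx : ∀ n, φ (x n) = x (n + 1))
    {p : ℤ → ℝ} (hp : ∀ n, 0 ≤ p n) (hsum : HasSum p 1) {ε : ℝ}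
    (hε : ∀ n, |p (n + 1) - p n * Real.exp (β * F (x n))| ≤ ε * p (n + 1)) :
    ∃ ω : CrossedProduct φ →L[ℂ] ℂ, ‖ω‖ ≤ 1 ∧ (∀ a, 0 ≤ ω (star a * a)) ∧ ω 1 = 1 ∧
      (∀ f b, ω (ofFunction φ f * b) = ω (b * ofFunction φ f)) ∧
      ∀ b, ‖ω (U φ * b) - ω (b * (U φ * ofFunction φ (complexPhase F (Complex.I * β))))‖ ≤
        ε * ‖b‖ := by
  obtain ⟨ψ, hψf, hψU⟩ := exists_orbit_hom x hx
  obtain ⟨ω, hω1, hω⟩ := exists_diagonal_functional ψ hp hsum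
  have hbf : ∀ f n, ψ (ofFunction φ f) (basisVec n) = f (x n) • basisVec n := by
    intro f n
    ext m
    rw [hψf]
    change _ = f (x n) * basisVec n m
    by_cases h : m = n
    · rw [h]
    · rw [basisVec_ne h, mul_zero, mul_zero]
  have hbU : ∀ n, ψ (U φ) (basisVec n) = basisVec (n + 1) := by
    intro n
    ext m
    rw [hψU]
    by_cases h : m = n + 1
    · subst h
      rw [add_neg_cancel_right, basisVec_self, basisVec_self]
    · rw [basisVec_ne h, basisVec_ne (by omega)]
  refine ⟨ω, hω1, fun a => ?_, ?_, fun f b => ?_, fun b => ?_⟩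
  · refine (hω (star a * a)).nonneg fun n => ?_
    rw [coeff_star_mul_self, ← Complex.ofReal_mul]
    exact Complex.zero_le_real.2 (mul_nonneg (hp n) (by positivity))
  · refine (hω 1).unique ?_
    have h := Complex.hasSum_ofReal.2 hsum
    rw [Complex.ofReal_one] at h
    refine h.congr_fun fun n => ?_
    rw [map_one]
    change (p n : ℂ) * basisVec n n = _
    rw [basisVec_self, mul_one]
  · refine (hω _).unique ?_
    convert hω (b * ofFunction φ f) using 2 with n
    congr 1
    rw [map_mul, map_mul]
    change ψ (ofFunction φ f) (ψ b (basisVec n)) n = ψ b (ψ (ofFunction φ f) (basisVec n)) n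
    rw [hψf, hbf, map_smul]
    rfl
  · set P := complexPhase F (Complex.I * β)
    -- Reindexing by one aligns the coefficients of U b with those of b U P.
    have h₁ : HasSum (fun n => (p (n + 1) : ℂ) * ψ b (basisVec (n + 1)) n) (ω (U φ * b)) := by
      have h := hω (U φ * b)
      rw [← (Equiv.addRight (1 : ℤ)).hasSum_iff] at h
      refine h.congr_fun fun n => ?_
      symm
      simp only [Function.comp_apply, Equiv.coe_addRight, map_mul]
      change (p (n + 1) : ℂ) * ψ (U φ) (ψ b (basisVec (n + 1))) (n + 1) = _
      rw [hψU, add_neg_cancel_right]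
    have h₂ : HasSum (fun n => (p n : ℂ) * (Real.exp (β * F (x n)) * ψ b (basisVec (n + 1)) n))
        (ω (b * (U φ * ofFunction φ P))) := by
      refine (hω (b * (U φ * ofFunction φ P))).congr_fun fun n => ?_
      symm
      congr 1
      rw [map_mul, map_mul]
      change ψ b (ψ (U φ) (ψ (ofFunction φ P) (basisVec n))) n = _
      rw [hbf, map_smul, hbU, map_smul, complexPhase_I_mul]
      push_cast
      rfl
    have h₃ := h₁.sub h₂
    rw [← h₃.tsum_eq]
    have h₄ : HasSum (fun n => p (n + 1)) 1 :=
      ((Equiv.addRight (1 : ℤ)).hasSum_iff (f := p)).2 hsum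
    have h₅ := (h₄.mul_left ε).mul_right ‖b‖
    rw [mul_one] at h₅
    refine tsum_of_norm_bounded h₅ fun n => ?_
    have e : (p (n + 1) : ℂ) * ψ b (basisVec (n + 1)) n -
        (p n : ℂ) * (Real.exp (β * F (x n)) * ψ b (basisVec (n + 1)) n) =
        ((p (n + 1) - p n * Real.exp (β * F (x n)) : ℝ) : ℂ) * ψ b (basisVec (n + 1)) n := by
      push_cast
      ring
    rw [e, norm_mul, Complex.norm_real, Real.norm_eq_abs]
    exact mul_le_mul (hε n) (norm_coeff_le ψ b _ _) (norm_nonneg _)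
      ((abs_nonneg _).trans (hε n))

/-- A KMS state exists as soon as there are approximately conformal weights on an orbit. -/
theorem exists_isKMSState_of_weights (F : C(X, ℝ)) (β : ℝ) (x : ℤ → X)
    (hx : ∀ n, φ (x n) = x (n + 1))
    (hw : ∀ ε : ℝ, 0 < ε → ∃ p : ℤ → ℝ, (∀ n, 0 ≤ p n) ∧ HasSum p 1 ∧
      ∀ n, |p (n + 1) - p n * Real.exp (β * F (x n))| ≤ ε * p (n + 1)) :
    ∃ ω : CrossedProduct φ →L[ℂ] ℂ, IsKMSState (crossedFlow φ F) β ω := by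
  have hk : ∀ k : ℕ, ∃ ω : CrossedProduct φ →L[ℂ] ℂ, ‖ω‖ ≤ 1 ∧
      (∀ a, 0 ≤ ω (star a * a)) ∧ ω 1 = 1 ∧
      (∀ f b, ω (ofFunction φ f * b) = ω (b * ofFunction φ f)) ∧
      ∀ b, ‖ω (U φ * b) - ω (b * (U φ * ofFunction φ (complexPhase F (Complex.I * β))))‖ ≤
        1 / ((k : ℝ) + 1) * ‖b‖ := fun k => by
    obtain ⟨p, hp, hsum, hε⟩ := hw (1 / ((k : ℝ) + 1)) (by positivity)
    exact exists_approx_KMS F β x hx hp hsum hε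
  choose ω hω1 hpos hone hcomm hU using hk
  -- Banach–Alaoglu gives compactness, not convergent subsequences for general X, so the limit is
  -- along an ultrafilter; every condition of `isKMSState_iff` passes to it pointwise.
  let 𝒰 : Ultrafilter ℕ := Ultrafilter.of atTop
  have h𝒰 : (𝒰 : Filter ℕ) ≤ atTop := Ultrafilter.of_le atTop
  have hcpt := WeakDual.isCompact_closedBall (𝕜 := ℂ) (E := CrossedProduct φ) 0 1
  obtain ⟨ω₀, -, hlim⟩ := hcpt.ultrafilter_le_nhds
    (𝒰.map fun k => StrongDual.toWeakDual (ω k)) (by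
      refine tendsto_principal.2 (Eventually.of_forall fun k => ?_)
      simpa using hω1 k)
  have ht : ∀ a, Tendsto (fun k => ω k a) 𝒰 (𝓝 (WeakDual.toStrongDual ω₀ a)) := fun a =>
    ((WeakDual.eval_continuous a).tendsto ω₀).comp hlim
  refine ⟨WeakDual.toStrongDual ω₀, isKMSState_iff.2 ⟨fun a => ?_, ?_, fun f b => ?_, fun b => ?_⟩⟩
  · exact ge_of_tendsto' (ht _) fun k => hpos k a
  · refine tendsto_nhds_unique (ht 1) ?_
    simp only [hone]
    exact tendsto_const_nhds
  · refine tendsto_nhds_unique (ht _) ?_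
    simp only [hcomm]
    exact ht _
  · have h₁ := (ht (U φ * b)).sub
      (ht (b * (U φ * ofFunction φ (complexPhase F (Complex.I * β)))))
    have h₂ : Tendsto (fun k : ℕ => 1 / ((k : ℝ) + 1) * ‖b‖) 𝒰 (𝓝 0) := by
      have := (tendsto_one_div_add_atTop_nhds_zero_nat (𝕜 := ℝ)).mul_const ‖b‖
      rw [zero_mul] at this
      exact this.mono_left h𝒰
    exact sub_eq_zero.1 (tendsto_nhds_unique h₁ (squeeze_zero_norm (fun k => hU k b) h₂))

end Existence

/-! ### The main theorem -/

/-- Existence of KMS states over a conjugate of an irrational rotation. -/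
theorem exists_isKMSState {φ h : UnitAddCircle ≃ₜ UnitAddCircle} {α : ℝ} (hα : Irrational α)
    (hφ : φ = (h.symm.trans (Homeomorph.addRight (α : UnitAddCircle))).trans h)
    {F : C(UnitAddCircle, ℝ)} (hF : ∫ x : UnitAddCircle, F (h x) = 0) (β : ℝ) :
    ∃ ω : CrossedProduct φ →L[ℂ] ℂ, IsKMSState (crossedFlow φ F) β ω := by
  refine exists_isKMSState_of_weights F β (fun n : ℤ => h (0 + n • (α : UnitAddCircle)))
    (fun n => ?_) fun ε hε => ?_
  · rw [hφ]
    simp [add_smul]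
  · refine exists_approx_conformal_weights hα
      (W := β • F.comp (h : C(UnitAddCircle, UnitAddCircle))) ?_ 0 hε
    change ∫ x : UnitAddCircle, β * F (h x) = 0
    rw [integral_const_mul, hF, mul_zero]

theorem theorem5p4 (φ h : UnitAddCircle ≃ₜ UnitAddCircle) (α : ℝ) (hα : Irrational α)
    (hφ : φ = (h.symm.trans (Homeomorph.addRight (α : UnitAddCircle))).trans h)
    (F : C(UnitAddCircle, ℝ)) :
    ((∃ β : ℝ, β ≠ 0 ∧ ∃ ω : CrossedProduct φ →L[ℂ] ℂ, IsKMSState (crossedFlow φ F) β ω) ↔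
      ∫ x : UnitAddCircle, F (h x) = 0) ∧
    (∫ x : UnitAddCircle, F (h x) = 0 →
      ∀ β : ℝ, ∃ ω : CrossedProduct φ →L[ℂ] ℂ, IsKMSState (crossedFlow φ F) β ω) ∧
    (BoundedVariationOn (fun t : ℝ => F (t : UnitAddCircle)) (Set.Icc 0 1) →
      ∀ β : ℝ, ∀ ω₁ ω₂ : CrossedProduct φ →L[ℂ] ℂ, IsKMSState (crossedFlow φ F) β ω₁ →
        IsKMSState (crossedFlow φ F) β ω₂ → ω₁ = ω₂) := by
  refine ⟨⟨?_, fun hF => ⟨1, one_ne_zero, exists_isKMSState hα hφ hF 1⟩⟩,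
    fun hF β => exists_isKMSState hα hφ hF β,
    fun hF β ω₁ ω₂ h₁ h₂ => h₁.unique hα hφ hF h₂⟩
  rintro ⟨β, hβ, ω, hω⟩
  exact hω.integral_eq_zero hα hφ hβ
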